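/- The following are equivalent over $\mathsf{RCA}_0$ (that is, $\mathsf{RCA}_0$ proves their equivalence; by completeness, they hold in the same models of $\mathsf{RCA}_0$, where models may have a nonstandard first-order part and an arbitrary nonempty family of sets as second-order part): 1. $\mathsf{ACA}_0$. 2. For every tree $T$, the set of all leaves of $T$ exists. 3. Parallelized $\mathsf{LPO}$: if $\langle p_i\rangle_{i\in\mathbb N}$ is a sequence of sequences $p_i:\mathbb N\to\mathbb N$ of natural numbers, then there is a function $z:\mathbb N\to\{0,1\}$ such that for each $i$, $z(i)=1$ if and only if $\exists n\,(p_i(n)=0)$. Here, in second order arithmetic, a tree is a set of (codes of) finite sequences of natural numbers that is closed under initial segments, and a leaf of a tree $T$ is a sequence in $T$ that has no proper extension in $T$. -/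

import Mathlib

universe u

namespace SecondOrderArithmetic

/-! ## The language of second order arithmetic

Number variables and set variables are each indexed by the natural numbers. -/

/-- Numerical terms: number variables, `0`, `1`, sums and products. -/
inductive Term : Type
  | var (x : ℕ)
  | zero
  | one
  | add (s t : Term)
  | mul (s t : Term)

/-- The number variables that occur in a term. -/
def Term.vars : Term → Finset ℕ
  | .var x => {x}
  | .zero => ∅
  | .one => ∅
  | .add s t => s.vars ∪ t.vars
  | .mul s t => s.vars ∪ t.vars

/-- Formulas of second order arithmetic. `mem t X` is the atomic formula `t ∈ X`; `all`, `ex`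
quantify over a number variable and `allSet`, `exSet` over a set variable. -/
inductive Formula : Type
  | eq (s t : Term)
  | lt (s t : Term)
  | mem (t : Term) (X : ℕ)
  | neg (φ : Formula)
  | and (φ ψ : Formula)
  | or (φ ψ : Formula)
  | imp (φ ψ : Formula)
  | iff (φ ψ : Formula)
  | all (x : ℕ) (φ : Formula)
  | ex (x : ℕ) (φ : Formula)
  | allSet (X : ℕ) (φ : Formula)
  | exSet (X : ℕ) (φ : Formula)

namespace Formula

/-- The bounded quantifier `∀ x < t, φ`, an abbreviation (used for `x` not occurring in `t`). -/
def ballLt (x : ℕ) (t : Term) (φ : Formula) : Formula := all x (imp (lt (.var x) t) φ)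

/-- The bounded quantifier `∃ x < t, φ`, an abbreviation (used for `x` not occurring in `t`). -/
def bexLt (x : ℕ) (t : Term) (φ : Formula) : Formula := ex x (and (lt (.var x) t) φ)

/-- Bounded quantifier formulas (`Σ⁰₀`): there are no set quantifiers, and all number quantifiers
are bounded. Free set variables are allowed. -/
inductive IsBounded : Formula → Prop
  | eq (s t : Term) : IsBounded (eq s t)
  | lt (s t : Term) : IsBounded (lt s t)
  | mem (t : Term) (X : ℕ) : IsBounded (mem t X)
  | neg {φ : Formula} : IsBounded φ → IsBounded (neg φ)
  | and {φ ψ : Formula} : IsBounded φ → IsBounded ψ → IsBounded (and φ ψ)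
  | or {φ ψ : Formula} : IsBounded φ → IsBounded ψ → IsBounded (or φ ψ)
  | imp {φ ψ : Formula} : IsBounded φ → IsBounded ψ → IsBounded (imp φ ψ)
  | iff {φ ψ : Formula} : IsBounded φ → IsBounded ψ → IsBounded (iff φ ψ)
  | ballLt {x : ℕ} {t : Term} {φ : Formula} :
      x ∉ t.vars → IsBounded φ → IsBounded (ballLt x t φ)
  | bexLt {x : ℕ} {t : Term} {φ : Formula} :
      x ∉ t.vars → IsBounded φ → IsBounded (bexLt x t φ)

/-- `Σ⁰₁` formulas: `∃ x, θ` with `θ` a bounded quantifier formula. -/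
def IsSigma01 (φ : Formula) : Prop := ∃ x θ, IsBounded θ ∧ φ = ex x θ

/-- `Π⁰₁` formulas: `∀ x, θ` with `θ` a bounded quantifier formula. -/
def IsPi01 (φ : Formula) : Prop := ∃ x θ, IsBounded θ ∧ φ = all x θ

/-- Arithmetical formulas: there are no set quantifiers. Free set variables are allowed. -/
def IsArithmetical : Formula → Prop
  | eq _ _ => True
  | lt _ _ => True
  | mem _ _ => True
  | neg φ => φ.IsArithmetical
  | and φ ψ => φ.IsArithmetical ∧ ψ.IsArithmetical
  | or φ ψ => φ.IsArithmetical ∧ ψ.IsArithmetical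
  | imp φ ψ => φ.IsArithmetical ∧ ψ.IsArithmetical
  | iff φ ψ => φ.IsArithmetical ∧ ψ.IsArithmetical
  | all _ φ => φ.IsArithmetical
  | ex _ φ => φ.IsArithmetical
  | allSet _ _ => False
  | exSet _ _ => False

end Formula

/-! ## Structures and satisfaction -/

/-- A structure for the language of second order arithmetic: number variables range over `Num`
(which may be nonstandard), set variables over the nonempty family `sets` of subsets of `Num`. -/
structure Structure where
  Num : Type u
  sets : Set (Set Num)
  sets_nonempty : sets.Nonempty
  zero : Num
  one : Num
  add : Num → Num → Num
  mul : Num → Num → Num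
  lt : Num → Num → Prop

namespace Structure

instance (M : Structure.{u}) : Zero M.Num := ⟨M.zero⟩
instance (M : Structure.{u}) : One M.Num := ⟨M.one⟩
instance (M : Structure.{u}) : Add M.Num := ⟨M.add⟩
instance (M : Structure.{u}) : Mul M.Num := ⟨M.mul⟩
instance (M : Structure.{u}) : LT M.Num := ⟨M.lt⟩

variable (M : Structure.{u})

/-- The value of a term under an assignment of the number variables. -/
def eval (v : ℕ → M.Num) : Term → M.Num
  | .var x => v x
  | .zero => 0
  | .one => 1
  | .add s t => eval v s + eval v t
  | .mul s t => eval v s * eval v t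

/-- `M.Sat φ v V`: the formula `φ` is true in `M` under the assignment `v` of the number variables
and `V` of the set variables. -/
def Sat : Formula → (ℕ → M.Num) → (ℕ → Set M.Num) → Prop
  | .eq s t, v, _ => M.eval v s = M.eval v t
  | .lt s t, v, _ => M.eval v s < M.eval v t
  | .mem t X, v, V => M.eval v t ∈ V X
  | .neg φ, v, V => ¬ Sat φ v V
  | .and φ ψ, v, V => Sat φ v V ∧ Sat ψ v V
  | .or φ ψ, v, V => Sat φ v V ∨ Sat ψ v V
  | .imp φ ψ, v, V => Sat φ v V → Sat ψ v V
  | .iff φ ψ, v, V => (Sat φ v V ↔ Sat ψ v V)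
  | .all x φ, v, V => ∀ a : M.Num, Sat φ (Function.update v x a) V
  | .ex x φ, v, V => ∃ a : M.Num, Sat φ (Function.update v x a) V
  | .allSet X φ, v, V => ∀ A ∈ M.sets, Sat φ v (Function.update V X A)
  | .exSet X φ, v, V => ∃ A ∈ M.sets, Sat φ v (Function.update V X A)

/-! ## The axiom systems `RCA₀` and `ACA₀` -/

/-- The basic axioms of arithmetic. -/
structure BasicAxioms : Prop where
  succ_ne_zero : ∀ n : M.Num, n + 1 ≠ 0
  succ_inj : ∀ m n : M.Num, m + 1 = n + 1 → m = n
  add_zero : ∀ m : M.Num, m + 0 = m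
  add_succ : ∀ m n : M.Num, m + (n + 1) = (m + n) + 1
  mul_zero : ∀ m : M.Num, m * 0 = 0
  mul_succ : ∀ m n : M.Num, m * (n + 1) = m * n + m
  not_lt_zero : ∀ m : M.Num, ¬ m < 0
  lt_succ : ∀ m n : M.Num, m < n + 1 ↔ m < n ∨ m = n

/-- The scheme of `Σ⁰₁` induction; parameters from `M` enter through the assignments `v`, `V`. -/
def Sigma01Induction : Prop :=
  ∀ (φ : Formula) (x : ℕ) (v : ℕ → M.Num) (V : ℕ → Set M.Num),
    φ.IsSigma01 → (∀ i, V i ∈ M.sets) →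
    M.Sat φ (Function.update v x 0) V →
    (∀ n : M.Num, M.Sat φ (Function.update v x n) V → M.Sat φ (Function.update v x (n + 1)) V) →
    ∀ n : M.Num, M.Sat φ (Function.update v x n) V

/-- The scheme of `Δ⁰₁` (recursive) comprehension. -/
def Delta01Comprehension : Prop :=
  ∀ (φ ψ : Formula) (x : ℕ) (v : ℕ → M.Num) (V : ℕ → Set M.Num),
    φ.IsSigma01 → ψ.IsPi01 → (∀ i, V i ∈ M.sets) →
    (∀ n : M.Num, M.Sat φ (Function.update v x n) V ↔ M.Sat ψ (Function.update v x n) V) →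
    ∃ X ∈ M.sets, ∀ n : M.Num, n ∈ X ↔ M.Sat φ (Function.update v x n) V

/-- The induction axiom for sets. -/
def SetInduction : Prop :=
  ∀ X ∈ M.sets, (0 : M.Num) ∈ X → (∀ n : M.Num, n ∈ X → n + 1 ∈ X) → ∀ n : M.Num, n ∈ X

/-- The scheme of arithmetical comprehension. -/
def ArithmeticalComprehension : Prop :=
  ∀ (φ : Formula) (x : ℕ) (v : ℕ → M.Num) (V : ℕ → Set M.Num),
    φ.IsArithmetical → (∀ i, V i ∈ M.sets) →
    ∃ X ∈ M.sets, ∀ n : M.Num, n ∈ X ↔ M.Sat φ (Function.update v x n) V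

/-- `M` is a model of `RCA₀`. -/
structure ModelsRCA0 : Prop where
  basic : M.BasicAxioms
  induction : M.Sigma01Induction
  comprehension : M.Delta01Comprehension

/-- `M` is a model of `ACA₀`. -/
structure ModelsACA0 : Prop where
  basic : M.BasicAxioms
  induction : M.SetInduction
  comprehension : M.ArithmeticalComprehension

/-! ## Pairs, finite sets, finite sequences, functions and trees, inside `M`

All quantifiers below range over the numbers of `M`, so that each notion is the interpretation in
`M` of the usual arithmetical definition. -/

variable {M}

/-- The code `(i, j) = (i + j)² + i` of a pair of numbers. -/
def pair (i j : M.Num) : M.Num := (i + j) * (i + j) + i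

/-- `c` is a triple `((k, m), n)`, a potential code of a finite set. -/
def IsTriple (c : M.Num) : Prop := ∃ k m n : M.Num, c = pair (pair k m) n

/-- `x` belongs to the finite set that the triple `c = ((k, m), n)` describes: `x < k` and
`m (x + 1) + 1` divides `n`. -/
def CodeMem (x c : M.Num) : Prop :=
  ∃ k m n : M.Num, c = pair (pair k m) n ∧ x < k ∧ ∃ q : M.Num, n = q * (m * (x + 1) + 1)

/-- `c` is the code of a finite set: the least of all triples that describe this set. -/
def IsFinsetCode (c : M.Num) : Prop :=
  IsTriple c ∧ ∀ d : M.Num, IsTriple d → (∀ x, CodeMem x d ↔ CodeMem x c) → ¬ d < c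

/-- `s` is (the code of) a finite sequence of length `l`, that is, of a finite set of pairs which is
a function with domain `{i | i < l}`. -/
def IsSeqOfLength (s l : M.Num) : Prop :=
  IsFinsetCode s ∧
  (∀ x, CodeMem x s → ∃ i j : M.Num, x = pair i j) ∧
  (∀ i j k : M.Num, CodeMem (pair i j) s → CodeMem (pair i k) s → j = k) ∧
  ∀ i : M.Num, i < l ↔ ∃ j : M.Num, CodeMem (pair i j) s

/-- `s` is (the code of) a finite sequence of numbers. -/
def IsSeq (s : M.Num) : Prop := ∃ l : M.Num, IsSeqOfLength s l

/-- For finite sequences `s` and `t`: `s` is an initial segment of `t` (possibly `t` itself), that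
is, `t` takes the value `s(i)` at every `i` below the length of `s`. -/
def InitialSegment (s t : M.Num) : Prop :=
  IsSeq s ∧ IsSeq t ∧ ∀ i j : M.Num, CodeMem (pair i j) s → CodeMem (pair i j) t

/-- A tree: a set of finite sequences that is closed under initial segments. -/
def IsTree (T : Set M.Num) : Prop :=
  (∀ s ∈ T, IsSeq s) ∧ ∀ s t : M.Num, t ∈ T → InitialSegment s t → s ∈ T

/-- `s` is a leaf of the tree `T`: an element of `T` that has no proper extension in `T`. -/
def IsLeaf (T : Set M.Num) (s : M.Num) : Prop :=
  s ∈ T ∧ ∀ t ∈ T, InitialSegment s t → t = s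

/-- `f` is a function from `X` to `Y`: a set of pairs in `X × Y` with exactly one value at every
element of `X`. -/
def IsFunction (X Y f : Set M.Num) : Prop :=
  (∀ c ∈ f, ∃ i ∈ X, ∃ j ∈ Y, c = pair i j) ∧ ∀ i ∈ X, ∃! j : M.Num, pair i j ∈ f

/-- The product `X × Y`, as a set of codes of pairs. -/
def prod (X Y : Set M.Num) : Set M.Num := {c | ∃ i ∈ X, ∃ j ∈ Y, c = pair i j}

variable (M)

/-- In `M`, every tree has a leaf set. -/
def LeafSetsExist : Prop :=
  ∀ T ∈ M.sets, IsTree T → ∃ L ∈ M.sets, ∀ s : M.Num, s ∈ L ↔ IsLeaf T s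

/-- In `M`, parallelized LPO holds. A sequence `⟨pᵢ⟩` of sequences of numbers is a function
`p : ℕ × ℕ → ℕ` with `pᵢ(n) = p(i, n)`, so `((i, n), 0) ∈ p` says `pᵢ(n) = 0`;
similarly `(i, 1) ∈ z` says `z(i) = 1`. -/
def ParallelLPO : Prop :=
  ∀ p ∈ M.sets, IsFunction (prod Set.univ Set.univ) Set.univ p →
    ∃ z ∈ M.sets, IsFunction (Set.univ : Set M.Num) {0, 1} z ∧
      ∀ i : M.Num, pair i 1 ∈ z ↔ ∃ n : M.Num, pair (pair i n) 0 ∈ p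

end Structure

end SecondOrderArithmetic

namespace SecondOrderArithmetic

namespace Structure

variable {M : Structure.{u}}

/-! ## Bounded definability -/

/-! All three principles are equivalent to one: every set of pairs in `M` has its projection in `M`
(`ProjectionsExist`). A projection is one unbounded number quantifier applied to a set; iterated
together with complements and intersections, it yields every arithmetical set.

The leaves of `T` are the elements of `T` outside the projection of {(s, t) : t ∈ T properly extends
s}, and parallelized LPO asks for the characteristic function of the projection of {(i, n) : pᵢ(n) =
0}. Conversely, to project `G`, take the tree of all sequences of length at most 2 in which ⟨i, n⟩
is admitted only if (i, n) ∈ `G`: then ⟨i⟩ is a leaf iff i is not in the projection. For LPO, let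
pᵢ(n) be 0 or 1 according to whether (i, n) ∈ `G`. Arithmetical comprehension follows by induction
on formulas (`ProjectionsExist.represents`): the satisfying assignments of a formula form a set of
tuple codes, and ∃ projects away the last coordinate.

The rest is done inside a possibly nonstandard `M`. The closure lemmas of `Tm` and `Bd` produce the
bounded formulas to which induction and comprehension apply. These make the numbers an ordered
semiring with an injective pairing, and `exists_code_pair` gives codes for ⟨i⟩ and ⟨i, n⟩. That no
unwanted elements enter these codes is `eq_or_eq_of_dvd`, a comparison of base-m digits. -/

theorem eval_congr (t : Term) {u u' : ℕ → M.Num} (h : ∀ i ∈ t.vars, u i = u' i) :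
    M.eval u t = M.eval u' t := by
  induction t with
  | var x => exact h x (by simp [Term.vars])
  | zero => rfl
  | one => rfl
  | add s t hs ht =>
    simp only [eval]
    rw [hs fun i hi => h i (by simp [Term.vars, hi]), ht fun i hi => h i (by simp [Term.vars, hi])]
  | mul s t hs ht =>
    simp only [eval]
    rw [hs fun i hi => h i (by simp [Term.vars, hi]), ht fun i hi => h i (by simp [Term.vars, hi])]

theorem exists_bound_vars (t : Term) : ∃ k, ∀ i ∈ t.vars, i < k :=
  ⟨t.vars.sup id + 1, fun _ hi => Nat.lt_succ_of_le (Finset.le_sup (f := id) hi)⟩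

theorem update_agree {α : Type*} {u u' : ℕ → α} {k : ℕ} (h : ∀ i < k, u i = u' i) (x : ℕ) (a : α) :
    ∀ i < k, Function.update u x a i = Function.update u' x a i := by
  intro i hi
  by_cases hx : i = x <;> simp [hx, h i hi]

/-- Satisfaction of a formula depends only on finitely many number variables. -/
theorem exists_sat_congr (M : Structure.{u}) (φ : Formula) :
    ∃ k, ∀ (V : ℕ → Set M.Num) (u u' : ℕ → M.Num), (∀ i < k, u i = u' i) →
      (M.Sat φ u V ↔ M.Sat φ u' V) := by
  induction φ with
  | eq s t =>
    obtain ⟨k, hk⟩ := exists_bound_vars s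
    obtain ⟨l, hl⟩ := exists_bound_vars t
    refine ⟨max k l, fun V u u' h => ?_⟩
    simp only [Sat]
    rw [eval_congr s fun i hi => h i (lt_max_of_lt_left (hk i hi)),
      eval_congr t fun i hi => h i (lt_max_of_lt_right (hl i hi))]
  | lt s t =>
    obtain ⟨k, hk⟩ := exists_bound_vars s
    obtain ⟨l, hl⟩ := exists_bound_vars t
    refine ⟨max k l, fun V u u' h => ?_⟩
    simp only [Sat]
    rw [eval_congr s fun i hi => h i (lt_max_of_lt_left (hk i hi)),
      eval_congr t fun i hi => h i (lt_max_of_lt_right (hl i hi))]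
  | mem t X =>
    obtain ⟨l, hl⟩ := exists_bound_vars t
    refine ⟨l, fun V u u' h => ?_⟩
    simp only [Sat]
    rw [eval_congr t fun i hi => h i (hl i hi)]
  | neg φ hφ =>
    obtain ⟨k, hk⟩ := hφ
    exact ⟨k, fun V u u' h => not_congr (hk V u u' h)⟩
  | and φ ψ hφ hψ =>
    obtain ⟨k, hk⟩ := hφ
    obtain ⟨l, hl⟩ := hψ
    exact ⟨max k l, fun V u u' h => and_congr (hk V u u' fun i hi => h i (lt_max_of_lt_left hi))
      (hl V u u' fun i hi => h i (lt_max_of_lt_right hi))⟩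
  | or φ ψ hφ hψ =>
    obtain ⟨k, hk⟩ := hφ
    obtain ⟨l, hl⟩ := hψ
    exact ⟨max k l, fun V u u' h => or_congr (hk V u u' fun i hi => h i (lt_max_of_lt_left hi))
      (hl V u u' fun i hi => h i (lt_max_of_lt_right hi))⟩
  | imp φ ψ hφ hψ =>
    obtain ⟨k, hk⟩ := hφ
    obtain ⟨l, hl⟩ := hψ
    exact ⟨max k l, fun V u u' h => imp_congr (hk V u u' fun i hi => h i (lt_max_of_lt_left hi))
      (hl V u u' fun i hi => h i (lt_max_of_lt_right hi))⟩
  | iff φ ψ hφ hψ =>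
    obtain ⟨k, hk⟩ := hφ
    obtain ⟨l, hl⟩ := hψ
    exact ⟨max k l, fun V u u' h => iff_congr (hk V u u' fun i hi => h i (lt_max_of_lt_left hi))
      (hl V u u' fun i hi => h i (lt_max_of_lt_right hi))⟩
  | all x φ hφ =>
    obtain ⟨k, hk⟩ := hφ
    exact ⟨k, fun V u u' h => forall_congr' fun a => hk V _ _ (update_agree h x a)⟩
  | ex x φ hφ =>
    obtain ⟨k, hk⟩ := hφ
    exact ⟨k, fun V u u' h => exists_congr fun a => hk V _ _ (update_agree h x a)⟩
  | allSet X φ hφ =>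
    obtain ⟨k, hk⟩ := hφ
    exact ⟨k, fun V u u' h => forall₂_congr fun A _ => hk _ _ _ h⟩
  | exSet X φ hφ =>
    obtain ⟨k, hk⟩ := hφ
    exact ⟨k, fun V u u' h => exists_congr fun A => and_congr_right fun _ => hk _ _ _ h⟩

/-- Supplies the variable of a vacuous quantifier. `IsSigma01` and `IsPi01` demand a leading
unbounded quantifier, so a bounded formula belongs to these classes only after such padding. -/
theorem exists_fresh (M : Structure.{u}) (φ : Formula) : ∃ y,
    ∀ (V : ℕ → Set M.Num) (u : ℕ → M.Num) (a : M.Num),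
      (M.Sat φ (Function.update u y a) V ↔ M.Sat φ u V) := by
  obtain ⟨k, hk⟩ := exists_sat_congr M φ
  exact ⟨k, fun V u a => hk _ _ _ fun i hi => Function.update_of_ne hi.ne _ _⟩

theorem sat_ex_fresh {φ : Formula} {y : ℕ} (hy : ∀ (V : ℕ → Set M.Num) (u : ℕ → M.Num) (a : M.Num),
      (M.Sat φ (Function.update u y a) V ↔ M.Sat φ u V)) (u : ℕ → M.Num) (V : ℕ → Set M.Num) :
    M.Sat (.ex y φ) u V ↔ M.Sat φ u V :=
  ⟨fun ⟨a, h⟩ => (hy V u a).1 h, fun h => ⟨0, (hy V u 0).2 h⟩⟩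

theorem sat_all_fresh {φ : Formula} {y : ℕ}
    (hy : ∀ (V : ℕ → Set M.Num) (u : ℕ → M.Num) (a : M.Num),
      (M.Sat φ (Function.update u y a) V ↔ M.Sat φ u V)) (u : ℕ → M.Num) (V : ℕ → Set M.Num) :
    M.Sat (.all y φ) u V ↔ M.Sat φ u V :=
  ⟨fun h => (hy V u 0).1 (h 0), fun h a => (hy V u a).2 h⟩

theorem bounded_induction (h : M.Sigma01Induction) {φ : Formula} (hφ : φ.IsBounded) (x : ℕ)
    (v : ℕ → M.Num) (V : ℕ → M.sets)
    (h0 : M.Sat φ (Function.update v x 0) (fun i => V i))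
    (h1 : ∀ n, M.Sat φ (Function.update v x n) (fun i => V i) →
      M.Sat φ (Function.update v x (n + 1)) (fun i => V i)) (n : M.Num) :
    M.Sat φ (Function.update v x n) (fun i => V i) := by
  obtain ⟨y, hy⟩ := exists_fresh M φ
  have := h (.ex y φ) x v (fun i => V i) ⟨y, φ, hφ, rfl⟩ (fun i => (V i).2)
  simp only [sat_ex_fresh hy] at this
  exact this h0 h1 n

theorem bounded_comprehension (h : M.Delta01Comprehension) {φ : Formula} (hφ : φ.IsBounded) (x : ℕ)
    (v : ℕ → M.Num) (V : ℕ → M.sets) :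
    ∃ X ∈ M.sets, ∀ n, n ∈ X ↔ M.Sat φ (Function.update v x n) (fun i => V i) := by
  obtain ⟨y, hy⟩ := exists_fresh M φ
  have := h (.ex y φ) (.all y φ) x v (fun i => V i) ⟨y, φ, hφ, rfl⟩ ⟨y, φ, hφ, rfl⟩
    (fun i => (V i).2)
  simp only [sat_ex_fresh hy, sat_all_fresh hy] at this
  exact this fun _ => trivial

/-- `t` is the value of a term in the first `n` number variables. -/
def Tm (n : ℕ) (t : (Fin n → M.Num) → M.Num) : Prop :=
  ∃ τ : Term, (∀ i ∈ τ.vars, i < n) ∧ ∀ u : ℕ → M.Num, M.eval u τ = t fun i => u i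

/-- `P` is defined by a bounded formula in the first `n` number variables and the sets `V`. -/
def Bd (V : ℕ → M.sets) (n : ℕ) (P : (Fin n → M.Num) → Prop) : Prop :=
  ∃ θ : Formula, θ.IsBounded ∧ ∀ u : ℕ → M.Num, M.Sat θ u (fun i => V i) ↔ P fun i => u i

namespace Tm

variable {n : ℕ} {s t : (Fin n → M.Num) → M.Num}

theorem var (i : Fin n) : Tm (M := M) n fun v => v i :=
  ⟨.var i, by simp [Term.vars], fun _ => rfl⟩

theorem zero : Tm (M := M) n fun _ => 0 := ⟨.zero, by simp [Term.vars], fun _ => rfl⟩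

theorem one : Tm (M := M) n fun _ => 1 := ⟨.one, by simp [Term.vars], fun _ => rfl⟩

theorem add (hs : Tm n s) (ht : Tm n t) : Tm n fun v => s v + t v := by
  obtain ⟨σ, hσ, h⟩ := hs
  obtain ⟨τ, hτ, h'⟩ := ht
  refine ⟨.add σ τ, ?_, fun u => by simp only [eval, h, h']⟩
  simp only [Term.vars, Finset.mem_union]
  rintro i (hi | hi)
  exacts [hσ i hi, hτ i hi]

theorem mul (hs : Tm n s) (ht : Tm n t) : Tm n fun v => s v * t v := by
  obtain ⟨σ, hσ, h⟩ := hs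
  obtain ⟨τ, hτ, h'⟩ := ht
  refine ⟨.mul σ τ, ?_, fun u => by simp only [eval, h, h']⟩
  simp only [Term.vars, Finset.mem_union]
  rintro i (hi | hi)
  exacts [hσ i hi, hτ i hi]

theorem pair (hs : Tm n s) (ht : Tm n t) : Tm n fun v => Structure.pair (s v) (t v) :=
  ((hs.add ht).mul (hs.add ht)).add hs

theorem init (ht : Tm n t) : Tm (n + 1) fun v => t (Fin.init v) := by
  obtain ⟨τ, hτ, h'⟩ := ht
  exact ⟨τ, fun i hi => (hτ i hi).trans (Nat.lt_succ_self n), fun u => h' u⟩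

end Tm

namespace Bd

variable {V : ℕ → M.sets} {n : ℕ} {s t : (Fin n → M.Num) → M.Num} {P Q : (Fin n → M.Num) → Prop}

theorem congr (h : Bd V n P) (hPQ : ∀ v, Q v ↔ P v) : Bd V n Q := by
  obtain rfl : Q = P := funext fun v => propext (hPQ v)
  exact h

theorem eq (hs : Tm n s) (ht : Tm n t) : Bd V n fun v => s v = t v := by
  obtain ⟨σ, hσ, h⟩ := hs
  obtain ⟨τ, hτ, h'⟩ := ht
  exact ⟨.eq σ τ, .eq σ τ, fun u => by simp only [Sat, h, h']⟩

theorem lt (hs : Tm n s) (ht : Tm n t) : Bd V n fun v => s v < t v := by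
  obtain ⟨σ, hσ, h⟩ := hs
  obtain ⟨τ, hτ, h'⟩ := ht
  exact ⟨.lt σ τ, .lt σ τ, fun u => by simp only [Sat, h, h']⟩

theorem mem (i : ℕ) (ht : Tm n t) : Bd V n fun v => t v ∈ (V i : Set M.Num) := by
  obtain ⟨τ, hτ, h'⟩ := ht
  exact ⟨.mem τ i, .mem τ i, fun u => by simp only [Sat, h']⟩

theorem not (hP : Bd V n P) : Bd V n fun v => ¬ P v := by
  obtain ⟨φ, hφ, h⟩ := hP
  exact ⟨.neg φ, .neg hφ, fun u => by simp only [Sat, h]⟩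

theorem and (hP : Bd V n P) (hQ : Bd V n Q) : Bd V n fun v => P v ∧ Q v := by
  obtain ⟨φ, hφ, h⟩ := hP
  obtain ⟨ψ, hψ, h'⟩ := hQ
  exact ⟨.and φ ψ, .and hφ hψ, fun u => by simp only [Sat, h, h']⟩

theorem or (hP : Bd V n P) (hQ : Bd V n Q) : Bd V n fun v => P v ∨ Q v := by
  obtain ⟨φ, hφ, h⟩ := hP
  obtain ⟨ψ, hψ, h'⟩ := hQ
  exact ⟨.or φ ψ, .or hφ hψ, fun u => by simp only [Sat, h, h']⟩

theorem imp (hP : Bd V n P) (hQ : Bd V n Q) : Bd V n fun v => P v → Q v := by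
  obtain ⟨φ, hφ, h⟩ := hP
  obtain ⟨ψ, hψ, h'⟩ := hQ
  exact ⟨.imp φ ψ, .imp hφ hψ, fun u => by simp only [Sat, h, h']⟩

theorem iff (hP : Bd V n P) (hQ : Bd V n Q) : Bd V n fun v => (P v ↔ Q v) := by
  obtain ⟨φ, hφ, h⟩ := hP
  obtain ⟨ψ, hψ, h'⟩ := hQ
  exact ⟨.iff φ ψ, .iff hφ hψ, fun u => by simp only [Sat, h, h']⟩

theorem restrict_update (u : ℕ → M.Num) (a : M.Num) :
    (Fin.init fun i : Fin (n + 1) => Function.update u n a i) = fun i : Fin n => u i := by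
  funext i
  simp [Fin.init, Function.update_of_ne i.2.ne]

/-- The bound variable is number `n`, the first one not in use. `Tm n` keeps it out of the bounding
term, as `IsBounded.bexLt` requires. -/
theorem bex {P : (Fin n → M.Num) → M.Num → Prop} (ht : Tm n t)
    (hP : Bd V (n + 1) fun v => P (Fin.init v) (v (Fin.last n))) :
    Bd V n fun v => ∃ a < t v, P v a := by
  obtain ⟨τ, hτ, h⟩ := ht
  obtain ⟨φ, hφ, h'⟩ := hP
  have hn : n ∉ τ.vars := fun hn => (hτ n hn).false
  refine ⟨.bexLt n τ φ, .bexLt hn hφ, fun u => exists_congr fun a => and_congr ?_ ?_⟩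
  · simp only [Sat, eval, Function.update_self]
    rw [eval_congr (u' := u) τ, h]
    exact fun i hi => Function.update_of_ne (hτ i hi).ne _ _
  · rw [h']
    simp only [restrict_update, Fin.val_last, Function.update_self]

theorem ball {P : (Fin n → M.Num) → M.Num → Prop} (ht : Tm n t)
    (hP : Bd V (n + 1) fun v => P (Fin.init v) (v (Fin.last n))) :
    Bd V n fun v => ∀ a < t v, P v a :=
  (bex (P := fun v a => ¬ P v a) ht hP.not).not.congr fun v => by simp

theorem exists_extend (w : Fin n → M.Num) : ∃ u : ℕ → M.Num, (fun i : Fin n => u i) = w :=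
  ⟨fun i => if h : i < n then w ⟨i, h⟩ else 0, by funext i; simp⟩

theorem induction {P : (Fin n → M.Num) → M.Num → Prop} (hM : M.ModelsRCA0)
    (hP : Bd V (n + 1) fun v => P (Fin.init v) (v (Fin.last n)))
    (w : Fin n → M.Num) (h0 : P w 0) (h1 : ∀ a, P w a → P w (a + 1)) (a : M.Num) : P w a := by
  obtain ⟨u, rfl⟩ := exists_extend w
  obtain ⟨φ, hφ, h⟩ := hP
  have := bounded_induction hM.induction hφ n u V
  simp only [h, restrict_update, Fin.val_last, Function.update_self] at this
  exact this h0 h1 a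

theorem comprehension {P : (Fin n → M.Num) → M.Num → Prop} (hM : M.ModelsRCA0)
    (hP : Bd V (n + 1) fun v => P (Fin.init v) (v (Fin.last n))) (w : Fin n → M.Num) :
    ∃ X ∈ M.sets, ∀ a, a ∈ X ↔ P w a := by
  obtain ⟨u, rfl⟩ := exists_extend w
  obtain ⟨φ, hφ, h⟩ := hP
  have := bounded_comprehension hM.comprehension hφ n u V
  simpa only [h, restrict_update, Fin.val_last, Function.update_self] using this

end Bd

end Structure

end SecondOrderArithmetic

namespace SecondOrderArithmetic

namespace Structure

variable {M : Structure.{u}}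

/-! ## Arithmetic in models of `RCA₀` -/

theorem nonempty_seq_sets (M : Structure.{u}) : Nonempty (ℕ → M.sets) :=
  ⟨fun _ => ⟨M.sets_nonempty.some, M.sets_nonempty.some_mem⟩⟩

namespace ModelsRCA0

variable (hM : M.ModelsRCA0)
include hM

/-- Purely arithmetical predicates need no set parameters, so any assignment of the set variables
will do; one exists because `sets` is nonempty. -/
theorem induction₀ {P : M.Num → Prop}
    (hP : ∀ V : ℕ → M.sets, Bd V 1 fun v => P (v (Fin.last 0)))
    (h0 : P 0) (h1 : ∀ a, P a → P (a + 1)) (a : M.Num) : P a := by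
  obtain ⟨V⟩ := nonempty_seq_sets M
  exact Bd.induction (P := fun _ => P) hM (hP V) ![] h0 h1 a

theorem induction₁ {P : M.Num → M.Num → Prop}
    (hP : ∀ V : ℕ → M.sets, Bd V 2 fun v => P (v 0) (v 1)) (x : M.Num)
    (h0 : P x 0) (h1 : ∀ a, P x a → P x (a + 1)) (a : M.Num) : P x a := by
  obtain ⟨V⟩ := nonempty_seq_sets M
  exact Bd.induction (P := fun v => P (v 0)) hM (hP V) ![x] h0 h1 a

theorem induction₂ {P : M.Num → M.Num → M.Num → Prop}
    (hP : ∀ V : ℕ → M.sets, Bd V 3 fun v => P (v 0) (v 1) (v 2)) (x y : M.Num)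
    (h0 : P x y 0) (h1 : ∀ a, P x y a → P x y (a + 1)) (a : M.Num) : P x y a := by
  obtain ⟨V⟩ := nonempty_seq_sets M
  exact Bd.induction (P := fun v => P (v 0) (v 1)) hM (hP V) ![x, y] h0 h1 a

theorem add_assoc (a b c : M.Num) : a + b + c = a + (b + c) := by
  refine hM.induction₂ (P := fun a b c => a + b + c = a + (b + c)) (fun V => ?_) a b ?_ ?_ c
  · exact .eq (((Tm.var _).add (.var _)).add (.var _)) ((Tm.var _).add ((Tm.var _).add (.var _)))
  · simp only [hM.basic.add_zero]
  · intro c h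
    simp only [hM.basic.add_succ, h]

theorem zero_add (a : M.Num) : 0 + a = a := by
  refine hM.induction₀ (P := fun a => 0 + a = a) (fun V => ?_) ?_ ?_ a
  · exact .eq (Tm.zero.add (.var _)) (.var _)
  · exact hM.basic.add_zero 0
  · intro c h
    simp only [hM.basic.add_succ, h]

theorem succ_add (a b : M.Num) : a + 1 + b = a + b + 1 := by
  refine hM.induction₁ (P := fun a b => a + 1 + b = a + b + 1) (fun V => ?_) a ?_ ?_ b
  · exact .eq (((Tm.var _).add .one).add (.var _)) (((Tm.var _).add (.var _)).add .one)
  · simp only [hM.basic.add_zero]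
  · intro c h
    simp only [hM.basic.add_succ, h]

theorem add_comm (a b : M.Num) : a + b = b + a := by
  refine hM.induction₁ (P := fun a b => a + b = b + a) (fun V => ?_) a ?_ ?_ b
  · exact .eq ((Tm.var _).add (.var _)) ((Tm.var _).add (.var _))
  · simp only [hM.basic.add_zero, hM.zero_add]
  · intro c h
    simp only [hM.basic.add_succ, hM.succ_add, h]

theorem mul_add (a b c : M.Num) : a * (b + c) = a * b + a * c := by
  refine hM.induction₂ (P := fun a b c => a * (b + c) = a * b + a * c) (fun V => ?_) a b ?_ ?_ c
  · exact .eq ((Tm.var _).mul ((Tm.var _).add (.var _)))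
      (((Tm.var _).mul (.var _)).add ((Tm.var _).mul (.var _)))
  · simp only [hM.basic.add_zero, hM.basic.mul_zero]
  · intro c h
    rw [hM.basic.add_succ, hM.basic.mul_succ, hM.basic.mul_succ, h, hM.add_assoc]

theorem mul_assoc (a b c : M.Num) : a * b * c = a * (b * c) := by
  refine hM.induction₂ (P := fun a b c => a * b * c = a * (b * c)) (fun V => ?_) a b ?_ ?_ c
  · exact .eq (((Tm.var _).mul (.var _)).mul (.var _)) ((Tm.var _).mul ((Tm.var _).mul (.var _)))
  · simp only [hM.basic.mul_zero]
  · intro c h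
    rw [hM.basic.mul_succ, hM.basic.mul_succ, hM.mul_add, h]

theorem zero_mul (a : M.Num) : 0 * a = 0 := by
  refine hM.induction₀ (P := fun a => 0 * a = 0) (fun V => ?_) ?_ ?_ a
  · exact .eq (Tm.zero.mul (.var _)) .zero
  · exact hM.basic.mul_zero 0
  · intro c h
    simp only [hM.basic.mul_succ, h, hM.basic.add_zero]

theorem succ_mul (a b : M.Num) : (a + 1) * b = a * b + b := by
  refine hM.induction₁ (P := fun a b => (a + 1) * b = a * b + b) (fun V => ?_) a ?_ ?_ b
  · exact .eq (((Tm.var _).add .one).mul (.var _)) (((Tm.var _).mul (.var _)).add (.var _))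
  · simp only [hM.basic.mul_zero, hM.basic.add_zero]
  · intro c h
    rw [hM.basic.mul_succ, hM.basic.mul_succ, h, hM.basic.add_succ, hM.basic.add_succ,
      hM.add_assoc _ c, hM.add_comm c a, ← hM.add_assoc]

theorem mul_comm (a b : M.Num) : a * b = b * a := by
  refine hM.induction₁ (P := fun a b => a * b = b * a) (fun V => ?_) a ?_ ?_ b
  · exact .eq ((Tm.var _).mul (.var _)) ((Tm.var _).mul (.var _))
  · simp only [hM.basic.mul_zero, hM.zero_mul]
  · intro c h
    simp only [hM.basic.mul_succ, hM.succ_mul, h]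

theorem mul_one (a : M.Num) : a * 1 = a := by
  have := hM.basic.mul_succ a 0
  rwa [hM.zero_add, hM.basic.mul_zero, hM.zero_add] at this

theorem lt_succ_self (a : M.Num) : a < a + 1 := (hM.basic.lt_succ _ _).2 (.inr rfl)

theorem eq_zero_or_pos (a : M.Num) : a = 0 ∨ 0 < a := by
  refine hM.induction₀ (P := fun a => a = 0 ∨ 0 < a) (fun V => ?_) (.inl rfl) ?_ a
  · exact .or (.eq (.var _) .zero) (.lt .zero (.var _))
  · rintro c (rfl | h)
    · exact .inr (hM.lt_succ_self 0)
    · exact .inr ((hM.basic.lt_succ _ _).2 (.inl h))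

theorem lt_trans {a b c : M.Num} : a < b → b < c → a < c := by
  refine hM.induction₂ (P := fun a b c => a < b → b < c → a < c) (fun V => ?_) a b ?_ ?_ c
  · exact .imp (.lt (.var _) (.var _)) (.imp (.lt (.var _) (.var _)) (.lt (.var _) (.var _)))
  · exact fun _ h => (hM.basic.not_lt_zero _ h).elim
  · intro c h hab hbc
    rcases (hM.basic.lt_succ _ _).1 hbc with hbc | rfl
    · exact (hM.basic.lt_succ _ _).2 (.inl (h hab hbc))
    · exact (hM.basic.lt_succ _ _).2 (.inl hab)

theorem succ_lt_succ {a b : M.Num} : a < b → a + 1 < b + 1 := by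
  refine hM.induction₁ (P := fun a b => a < b → a + 1 < b + 1) (fun V => ?_) a ?_ ?_ b
  · exact .imp (.lt (.var _) (.var _)) (.lt ((Tm.var _).add .one) ((Tm.var _).add .one))
  · exact fun h => (hM.basic.not_lt_zero _ h).elim
  · intro c h hac
    rcases (hM.basic.lt_succ _ _).1 hac with hac | rfl
    · exact (hM.basic.lt_succ _ _).2 (.inl (h hac))
    · exact hM.lt_succ_self _

theorem lt_irrefl (a : M.Num) : ¬ a < a := by
  refine hM.induction₀ (P := fun a => ¬ a < a) (fun V => ?_) (hM.basic.not_lt_zero 0) ?_ a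
  · exact .not (.lt (.var _) (.var _))
  · intro a h h'
    rcases (hM.basic.lt_succ _ _).1 h' with h' | h'
    · exact h (hM.lt_trans (hM.lt_succ_self a) h')
    · exact h (by simpa only [h'] using hM.lt_succ_self a)

theorem lt_trichotomy (a b : M.Num) : a < b ∨ a = b ∨ b < a := by
  refine hM.induction₁ (P := fun a b => a < b ∨ a = b ∨ b < a) (fun V => ?_) a ?_ ?_ b
  · exact .or (.lt (.var _) (.var _)) (.or (.eq (.var _) (.var _)) (.lt (.var _) (.var _)))
  · exact .inr (hM.eq_zero_or_pos a)
  · rintro c (h | rfl | h)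
    · exact .inl (hM.lt_trans h (hM.lt_succ_self c))
    · exact .inl (hM.lt_succ_self _)
    · rcases (hM.basic.lt_succ _ _).1 (hM.succ_lt_succ h) with h | h
      · exact .inr (.inr h)
      · exact .inr (.inl h.symm)

theorem add_lt_add_right {a b : M.Num} (c : M.Num) : a < b → a + c < b + c := by
  refine hM.induction₂ (P := fun a b c => a < b → a + c < b + c) (fun V => ?_) a b ?_ ?_ c
  · exact .imp (.lt (.var _) (.var _)) (.lt ((Tm.var _).add (.var _)) ((Tm.var _).add (.var _)))
  · simp only [hM.basic.add_zero, imp_self]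
  · intro c h hab
    simp only [hM.basic.add_succ]
    exact hM.succ_lt_succ (h hab)

theorem mul_lt_mul_succ {a b : M.Num} (c : M.Num) : a < b → a * (c + 1) < b * (c + 1) := by
  refine hM.induction₂ (P := fun a b c => a < b → a * (c + 1) < b * (c + 1)) (fun V => ?_) a b ?_ ?_
    c
  · exact .imp (.lt (.var _) (.var _))
      (.lt ((Tm.var _).mul ((Tm.var _).add .one)) ((Tm.var _).mul ((Tm.var _).add .one)))
  · simp only [hM.zero_add, hM.mul_one, imp_self]
  · intro c h hab
    rw [hM.basic.mul_succ a, hM.basic.mul_succ b]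
    refine hM.lt_trans (hM.add_lt_add_right _ (h hab)) ?_
    rw [hM.add_comm _ a, hM.add_comm _ b]
    exact hM.add_lt_add_right _ hab

theorem eq_zero_or_succ (a : M.Num) : a = 0 ∨ ∃ b < a, a = b + 1 := by
  refine hM.induction₀ (P := fun a => a = 0 ∨ ∃ b < a, a = b + 1) (fun V => ?_) (.inl rfl) ?_ a
  -- The clause `b < a` in the statement is what keeps this formula bounded.
  · exact .or (.eq (.var _) .zero) (.bex (P := fun v b => v (Fin.last 0) = b + 1) (.var _)
      (.eq (Tm.var _) ((Tm.var _).add .one)))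
  · exact fun a _ => .inr ⟨a, hM.lt_succ_self a, rfl⟩

end ModelsRCA0

/-! ### The ordered semiring of numbers, and the pairing function -/

variable [hM : Fact M.ModelsRCA0]

noncomputable instance : CommSemiring M.Num where
  zero := M.zero
  one := M.one
  add := M.add
  mul := M.mul
  nsmul := nsmulRec
  add_assoc := hM.out.add_assoc
  add_comm := hM.out.add_comm
  zero_add := hM.out.zero_add
  add_zero := hM.out.basic.add_zero
  left_distrib := hM.out.mul_add
  right_distrib a b c := by
    change (a + b) * c = a * c + b * c
    rw [hM.out.mul_comm, hM.out.mul_add, hM.out.mul_comm c, hM.out.mul_comm c]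
  zero_mul := hM.out.zero_mul
  mul_zero := hM.out.basic.mul_zero
  mul_assoc := hM.out.mul_assoc
  mul_comm := hM.out.mul_comm
  one_mul a := (hM.out.mul_comm _ _).trans (hM.out.mul_one a)
  mul_one := hM.out.mul_one

noncomputable instance : LinearOrder M.Num where
  lt := M.lt
  le a b := a < b ∨ a = b
  le_refl a := .inr rfl
  le_trans a b c := by
    rintro (h | rfl) (h' | rfl)
    exacts [.inl (hM.out.lt_trans h h'), .inl h, .inl h', .inr rfl]
  le_antisymm a b := by
    rintro (h | rfl) (h' | h')
    exacts [(hM.out.lt_irrefl a (hM.out.lt_trans h h')).elim, h'.symm, rfl, rfl]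
  lt_iff_le_not_ge a b := by
    constructor
    · rintro h
      refine ⟨.inl h, ?_⟩
      rintro (h' | rfl)
      exacts [hM.out.lt_irrefl a (hM.out.lt_trans h h'), hM.out.lt_irrefl _ h]
    · rintro ⟨h | rfl, h'⟩
      exacts [h, (h' (.inr rfl)).elim]
  le_total a b := by
    rcases hM.out.lt_trichotomy a b with h | h | h
    exacts [.inl (.inl h), .inl (.inr h), .inr (.inl h)]
  toDecidableLE := Classical.decRel _

instance : IsOrderedCancelAddMonoid M.Num :=
  .of_add_lt_add_left fun c a b h => by
    simpa only [add_comm c] using hM.out.add_lt_add_right c h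

theorem lt_add_one_iff {a b : M.Num} : a < b + 1 ↔ a ≤ b := hM.out.basic.lt_succ a b

theorem num_nonneg (a : M.Num) : 0 ≤ a :=
  (hM.out.eq_zero_or_pos a).elim (fun h => h.ge) le_of_lt

theorem add_one_le_iff {a b : M.Num} : a + 1 ≤ b ↔ a < b := by
  rw [← lt_add_one_iff, add_lt_add_iff_right]

instance : IsStrictOrderedRing M.Num where
  zero_le_one := num_nonneg 1
  exists_pair_ne := ⟨0, 1, (hM.out.lt_succ_self 0).ne.trans_eq (hM.out.zero_add 1)⟩
  mul_lt_mul_of_pos_left a ha b c h := by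
    obtain rfl | ⟨d, -, rfl⟩ := hM.out.eq_zero_or_succ a
    · exact (hM.out.lt_irrefl _ ha).elim
    · simpa only [mul_comm _ (d + 1)] using hM.out.mul_lt_mul_succ d h
  mul_lt_mul_of_pos_right a ha b c h := by
    obtain rfl | ⟨d, -, rfl⟩ := hM.out.eq_zero_or_succ a
    · exact (hM.out.lt_irrefl _ ha).elim
    · exact hM.out.mul_lt_mul_succ d h

/-- Stands in for subtraction. The difference is bounded by `b`, so induction on `b` applies; `≤` is
spelled out as a disjunction because formulas have only `<` and `=`. -/
theorem exists_add_of_le {a b : M.Num} (h : a ≤ b) : ∃ c, b = a + c := by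
  have : ∃ c < b + 1, a ≤ b → b = a + c := by
    refine hM.out.induction₁ (P := fun a b => ∃ c < b + 1, (a < b ∨ a = b) → b = a + c) (fun V => ?_)
      a ?_ ?_ b
    · exact .bex (P := fun v c => (v 0 < v 1 ∨ v 0 = v 1) → v 1 = v 0 + c) ((Tm.var _).add .one)
        (.imp (.or (.lt (.var _) (.var _)) (.eq (.var _) (.var _)))
          (.eq (.var _) ((Tm.var _).add (.var _))))
    · exact ⟨0, lt_add_one_iff.2 le_rfl, fun h => by rw [add_zero, (num_nonneg a).antisymm' h]⟩
    · rintro b ⟨c, hc, h⟩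
      by_cases hab : a ≤ b
      · exact ⟨c + 1, by gcongr, fun _ => by rw [← add_assoc, ← h hab]⟩
      · refine ⟨0, lt_add_one_iff.2 (num_nonneg _), fun h' => ?_⟩
        rw [add_zero]
        exact (h'.resolve_left fun h'' => hab (lt_add_one_iff.1 h'')).symm
  obtain ⟨c, -, hc⟩ := this
  exact ⟨c, hc h⟩

/-- The least number principle for bounded formulas. -/
theorem Bd.exists_least {V : ℕ → M.sets} {n : ℕ} {P : (Fin n → M.Num) → M.Num → Prop}
    (hP : Bd V (n + 1) fun v => P (Fin.init v) (v (Fin.last n))) (w : Fin n → M.Num)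
    (h : ∃ a, P w a) : ∃ a, P w a ∧ ∀ b < a, ¬ P w b := by
  by_contra! hcon
  obtain ⟨X, hX, hXP⟩ := Bd.comprehension hM.out hP w
  -- Having `X` as a set turns strong induction into an induction on a formula with one parameter
  -- `X`, without renaming the variables of `P`.
  have key : ∀ a, ∀ b < a, b ∉ X := by
    refine Bd.induction (V := fun _ => ⟨X, hX⟩) (P := fun _ a => ∀ b < a, b ∉ X) hM.out
      (.ball (P := fun v b => b ∉ X) (.var _) (.not (.mem 0 (.var _)))) ![] ?_ ?_
    · exact fun b hb => (hM.out.basic.not_lt_zero _ hb).elim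
    · intro a ih b hb hbX
      obtain ⟨c, hc, hcP⟩ := hcon b ((hXP b).1 hbX)
      exact ih c (hc.trans_le (lt_add_one_iff.1 hb)) ((hXP c).2 hcP)
  obtain ⟨a, ha⟩ := h
  exact key (a + 1) a (lt_add_one_iff.2 le_rfl) ((hXP a).2 ha)

theorem le_pair_left (i j : M.Num) : i ≤ pair i j :=
  le_add_of_nonneg_left (num_nonneg _)

theorem le_mul_self (a : M.Num) : a ≤ a * a := by
  obtain rfl | ⟨d, -, rfl⟩ := hM.out.eq_zero_or_succ a
  · exact num_nonneg _
  · exact le_mul_of_one_le_left (num_nonneg _) (le_add_of_nonneg_left (num_nonneg d))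

theorem le_pair_right (i j : M.Num) : j ≤ pair i j :=
  calc j ≤ i + j := le_add_of_nonneg_left (num_nonneg _)
    _ ≤ (i + j) * (i + j) := le_mul_self _
    _ ≤ pair i j := le_add_of_nonneg_right (num_nonneg _)

/-- With s = i + j, the code lies between s² and s² + s < (s + 1)², so the codes for different sums
occupy disjoint intervals. -/
theorem pair_lt_of_add_lt {i j i' j' : M.Num} (h : i + j < i' + j') : pair i j < pair i' j' :=
  calc pair i j ≤ (i + j) * (i + j) + (i + j) := by
        unfold pair
        gcongr
        exact le_add_of_nonneg_right (num_nonneg _)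
    _ < (i + j + 1) * (i + j + 1) := by
        rw [← add_one_le_iff, show (i + j + 1) * (i + j + 1) =
          (i + j) * (i + j) + (i + j) + 1 + (i + j) by ring]
        exact le_add_of_nonneg_right (num_nonneg _)
    _ ≤ (i' + j') * (i' + j') := by
        have := add_one_le_iff.2 h
        exact mul_le_mul this this (num_nonneg _) (num_nonneg _)
    _ ≤ pair i' j' := le_add_of_nonneg_right (num_nonneg _)

theorem pair_inj {i j i' j' : M.Num} : pair i j = pair i' j' ↔ i = i' ∧ j = j' := by
  refine ⟨fun h => ?_, by rintro ⟨rfl, rfl⟩; rfl⟩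
  have hs : i + j = i' + j' := by
    rcases lt_trichotomy (i + j) (i' + j') with hlt | heq | hlt
    · exact ((pair_lt_of_add_lt hlt).ne h).elim
    · exact heq
    · exact ((pair_lt_of_add_lt hlt).ne h.symm).elim
  have hi : i = i' := by
    unfold pair at h
    rw [hs] at h
    exact add_left_cancel h
  subst hi
  exact ⟨rfl, add_left_cancel hs⟩

end Structure

end SecondOrderArithmetic

namespace SecondOrderArithmetic

namespace Structure

variable {M : Structure.{u}}

variable [hM : Fact M.ModelsRCA0]

/-! ## Codes of finite sets -/

theorem lt_of_codeMem {x c : M.Num} (h : CodeMem x c) : x < c := by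
  obtain ⟨k, m, n, rfl, hx, -⟩ := h
  exact hx.trans_le ((le_pair_left k m).trans (le_pair_left _ n))

theorem lt_of_codeMem_pair_left {i j c : M.Num} (h : CodeMem (pair i j) c) : i < c :=
  (le_pair_left i j).trans_lt (lt_of_codeMem h)

theorem lt_of_codeMem_pair_right {i j c : M.Num} (h : CodeMem (pair i j) c) : j < c :=
  (le_pair_right i j).trans_lt (lt_of_codeMem h)

/-- The components of a triple are at most its code, and the quotient is at most `n` because the
divisor is at least 1. Hence membership in a code is a bounded relation. -/
theorem codeMem_iff_bounded {x c : M.Num} : CodeMem x c ↔ ∃ k < c + 1, ∃ m < c + 1, ∃ n < c + 1,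
    c = pair (pair k m) n ∧ x < k ∧ ∃ q < n + 1, n = q * (m * (x + 1) + 1) := by
  constructor
  · rintro ⟨k, m, n, rfl, hx, q, hq⟩
    refine ⟨k, lt_add_one_iff.2 ((le_pair_left k m).trans (le_pair_left _ n)),
      m, lt_add_one_iff.2 ((le_pair_right k m).trans (le_pair_left _ n)),
      n, lt_add_one_iff.2 (le_pair_right _ n), rfl, hx, q, lt_add_one_iff.2 ?_, hq⟩
    rw [hq]
    exact le_mul_of_one_le_right (num_nonneg _) (le_add_of_nonneg_left (num_nonneg _))
  · rintro ⟨k, -, m, -, n, -, h, hx, q, -, hq⟩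
    exact ⟨k, m, n, h, hx, q, hq⟩

theorem isTriple_iff_bounded {c : M.Num} : IsTriple c ↔
    ∃ k < c + 1, ∃ m < c + 1, ∃ n < c + 1, c = pair (pair k m) n := by
  constructor
  · rintro ⟨k, m, n, rfl⟩
    exact ⟨k, lt_add_one_iff.2 ((le_pair_left k m).trans (le_pair_left _ n)),
      m, lt_add_one_iff.2 ((le_pair_right k m).trans (le_pair_left _ n)),
      n, lt_add_one_iff.2 (le_pair_right _ n), rfl⟩
  · rintro ⟨k, -, m, -, n, -, h⟩
    exact ⟨k, m, n, h⟩

theorem sameMembers_iff_bounded {c d : M.Num} : (∀ x, CodeMem x d ↔ CodeMem x c) ↔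
    ∀ x < c + d, (CodeMem x d ↔ CodeMem x c) := by
  refine ⟨fun h x _ => h x, fun h x => ⟨fun hx => ?_, fun hx => ?_⟩⟩
  · exact (h x ((lt_of_codeMem hx).trans_le (le_add_of_nonneg_left (num_nonneg _)))).1 hx
  · exact (h x ((lt_of_codeMem hx).trans_le (le_add_of_nonneg_right (num_nonneg _)))).2 hx

namespace Bd

variable {V : ℕ → M.sets} {n : ℕ} {s t : (Fin n → M.Num) → M.Num}

theorem codeMem (hs : Tm n s) (ht : Tm n t) : Bd V n fun v => CodeMem (s v) (t v) := by
  refine Bd.congr ?_ fun v => codeMem_iff_bounded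
  refine bex (P := fun v k => ∃ m < t v + 1, ∃ n < t v + 1,
    t v = Structure.pair (Structure.pair k m) n ∧ s v < k ∧
      ∃ q < n + 1, n = q * (m * (s v + 1) + 1)) (ht.add .one) ?_
  refine bex (ht.init.add .one) ?_
  refine bex (ht.init.init.add .one) ?_
  refine .and (.eq ht.init.init.init (((Tm.var _).pair (.var _)).pair (.var _)))
    (.and (.lt hs.init.init.init (.var _)) ?_)
  exact bex ((Tm.var _).add .one) (.eq (.var _)
    ((Tm.var _).mul (((Tm.var _).mul (hs.init.init.init.init.add .one)).add .one)))

theorem isTriple (ht : Tm n t) : Bd V n fun v => IsTriple (t v) := by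
  refine Bd.congr ?_ fun v => isTriple_iff_bounded
  refine bex (ht.add .one) ?_
  refine bex (ht.init.add .one) ?_
  refine bex (ht.init.init.add .one) ?_
  exact .eq ht.init.init.init (((Tm.var _).pair (.var _)).pair (.var _))

theorem sameMembers (hs : Tm n s) (ht : Tm n t) :
    Bd V n fun v => ∀ x, CodeMem x (s v) ↔ CodeMem x (t v) := by
  refine Bd.congr ?_ fun v => sameMembers_iff_bounded
  exact ball (ht.add hs) (.iff (.codeMem (.var _) hs.init) (.codeMem (.var _) ht.init))

theorem isFinsetCode (ht : Tm n t) : Bd V n fun v => IsFinsetCode (t v) := by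
  refine Bd.congr (Q := fun v => IsFinsetCode (t v)) (P := fun v => IsTriple (t v) ∧ ∀ d < t v,
    ¬ (IsTriple d ∧ ∀ x, CodeMem x d ↔ CodeMem x (t v))) ?_ fun v => ?_
  · exact .and (.isTriple ht) (.ball ht (.not (.and (.isTriple (.var _))
      (.sameMembers (.var _) ht.init))))
  · exact and_congr_right fun _ => ⟨fun h d hd hc => h d hc.1 hc.2 hd,
      fun h d h1 h2 hd => h d hd ⟨h1, h2⟩⟩

end Bd

/-- Neither code can be smaller than the other, since each is the least triple for the same set.
This extensionality later turns equal members into equal sequences. -/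
theorem IsFinsetCode.eq {c d : M.Num} (hc : IsFinsetCode c) (hd : IsFinsetCode d)
    (h : ∀ x, CodeMem x c ↔ CodeMem x d) : c = d :=
  le_antisymm (not_lt.1 (hc.2 d hd.1 fun x => (h x).symm)) (not_lt.1 (hd.2 c hc.1 h))

theorem exists_isFinsetCode {c : M.Num} (hc : IsTriple c) :
    ∃ d : M.Num, IsFinsetCode d ∧ ∀ x, CodeMem x d ↔ CodeMem x c := by
  obtain ⟨V⟩ := nonempty_seq_sets M
  obtain ⟨d, ⟨h1, h2⟩, h3⟩ := Bd.exists_least (V := V)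
    (P := fun v d => IsTriple d ∧ ∀ x, CodeMem x d ↔ CodeMem x (v 0))
    (.and (.isTriple (.var _)) (.sameMembers (.var _) (.var _))) ![c] ⟨c, hc, fun _ => Iff.rfl⟩
  exact ⟨d, ⟨h1, fun e he h hlt => h3 e hlt ⟨he, fun x => (h x).trans (h2 x)⟩⟩, h2⟩

theorem exists_div_mod (q : M.Num) {m : M.Num} (hm : 0 < m) : ∃ r e, q = m * r + e ∧ e < m := by
  have : ∃ r < q + 1, ∃ e < m, q = m * r + e := by
    refine hM.out.induction₁ (P := fun m q => 0 < m → ∃ r < q + 1, ∃ e < m, q = m * r + e)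
      (fun V => ?_) m ?_ ?_ q hm
    · refine .imp (.lt .zero (.var _)) (.bex (P := fun v r => ∃ e < v 0, v 1 = v 0 * r + e)
        ((Tm.var _).add .one) (.bex (P := fun v e => v 1 = v 0 * v (Fin.last 2) + e) (.var _)
          (.eq (.var _) (((Tm.var _).mul (.var _)).add (.var _)))))
    · exact fun hm => ⟨0, lt_add_one_iff.2 le_rfl, 0, hm, by simp⟩
    · rintro q ih hm
      obtain ⟨r, hr, e, he, rfl⟩ := ih hm
      rcases (add_one_le_iff.2 he).lt_or_eq with h | h
      · exact ⟨r, hr.trans (lt_add_one_iff.2 le_rfl), e + 1, h, by ring⟩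
      · exact ⟨r + 1, by gcongr, 0, hm, by rw [add_assoc, h]; ring⟩
  obtain ⟨r, -, e, he, h⟩ := this
  exact ⟨r, e, h, he⟩

theorem div_mod_unique {m r e r' e' : M.Num} (he : e < m) (he' : e' < m)
    (h : m * r + e = m * r' + e') : r = r' ∧ e = e' := by
  have key : ∀ {r e r' e' : M.Num}, e < m → r < r' → m * r + e < m * r' + e' := by
    intro r e r' e' he hr
    calc m * r + e < m * r + m := by gcongr
      _ = m * (r + 1) := by ring
      _ ≤ m * r' := mul_le_mul_of_nonneg_left (add_one_le_iff.2 hr) (num_nonneg _)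
      _ ≤ m * r' + e' := le_add_of_nonneg_right (num_nonneg _)
  rcases lt_trichotomy r r' with hr | rfl | hr
  · exact ((key he hr).ne h).elim
  · exact ⟨rfl, add_left_cancel h⟩
  · exact ((key he' hr).ne h.symm).elim

/-- Vieta without subtraction: write the larger of `x` and `a` as the smaller plus `d`. Cancelling
in the product equation leaves `d` times an equality, so `d = 0` or `x = b`. -/
theorem eq_or_eq_of_add_mul_eq {r x a b : M.Num} (hs : r + x = a + b) (hp : r * x = a * b) :
    x = a ∨ x = b := by
  rcases le_total a x with h | h
  · obtain ⟨d, rfl⟩ := exists_add_of_le h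
    have hb : b = r + d := add_left_cancel (a := a) (by rw [← hs]; ring)
    subst hb
    have : d * r = d * a := add_left_cancel (a := a * r) (by linear_combination hp)
    rcases hM.out.eq_zero_or_pos d with rfl | hd
    · left; ring
    · right
      rw [(le_of_mul_le_mul_left this.le hd).antisymm (le_of_mul_le_mul_left this.ge hd)]
  · obtain ⟨d, rfl⟩ := exists_add_of_le h
    have hr : r = d + b := add_left_cancel (a := x) (by rw [add_comm x r, hs]; ring)
    subst hr
    have : d * x = d * b := add_left_cancel (a := x * b) (by linear_combination hp)
    rcases hM.out.eq_zero_or_pos d with rfl | hd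
    · left; ring
    · right
      exact (le_of_mul_le_mul_left this.le hd).antisymm (le_of_mul_le_mul_left this.ge hd)

/-- Base-m digits replace coprimality. Reducing mod m shows q = mr + 1. Dividing by m then gives
m(ab) + (a + b) = m(rx) + (r + x); size forces r ≤ ab, so both sums are digits below m. Hence r and
x have the same sum and product as a and b. -/
theorem eq_or_eq_of_dvd {q m x a b : M.Num} (hx : 1 ≤ x) (hxab : x ≤ a + b)
    (hm : a * b + (a + b) < m) (hm1 : 1 < m)
    (h : (m * a + 1) * (m * b + 1) = q * (m * x + 1)) : x = a ∨ x = b := by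
  have hm0 : 0 < m := (num_nonneg _).trans_lt hm
  have hab : a + b < m := (le_add_of_nonneg_left (num_nonneg _)).trans_lt hm
  obtain ⟨r, e, rfl, he⟩ := exists_div_mod q hm0
  -- Both sides of `h` are divided by `m`; the remainders are 1 and `e`, so `e = 1`.
  obtain ⟨h1, rfl⟩ := div_mod_unique (m := m) (r := m * (a * b) + (a + b))
    (r' := m * (r * x) + (r + e * x)) hm1 he (by linear_combination h)
  rw [one_mul] at h1
  have hr : r ≤ a * b := by
    by_contra! hlt
    refine lt_irrefl (m * (a * b) + (a + b)) ?_
    calc m * (a * b) + (a + b) < m * (a * b) + m := by gcongr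
      _ = m * (a * b + 1) * 1 := by ring
      _ ≤ m * r * x := by
        have := add_one_le_iff.2 hlt
        exact mul_le_mul (mul_le_mul_of_nonneg_left this hm0.le) hx (num_nonneg _) (num_nonneg _)
      _ ≤ m * (r * x) + (r + x) := by
        rw [mul_assoc]
        exact le_add_of_nonneg_right (num_nonneg _)
      _ = m * (a * b) + (a + b) := h1.symm
  obtain ⟨hp, hs⟩ := div_mod_unique hab ((add_le_add hr hxab).trans_lt hm) h1
  exact eq_or_eq_of_add_mul_eq hs.symm hp.symm

/-- The unordered pair of two numbers is coded by some number. -/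
theorem exists_code_pair (a b : M.Num) :
    ∃ c : M.Num, IsFinsetCode c ∧ ∀ x, CodeMem x c ↔ x = a ∨ x = b := by
  -- `CodeMem` uses x + 1, so this is the least modulus exceeding the bound of `eq_or_eq_of_dvd` for
  -- a + 1 and b + 1.
  set m := (a + 1) * (b + 1) + ((a + 1) + (b + 1)) + 1 with hm
  have hlt : (a + 1) * (b + 1) + ((a + 1) + (b + 1)) < m := lt_add_one_iff.2 le_rfl
  have hm1 : 1 < m := lt_of_le_of_lt
    (calc 1 ≤ a + 1 := le_add_of_nonneg_left (num_nonneg _)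
      _ ≤ (a + 1) + (b + 1) := le_add_of_nonneg_right (num_nonneg _)
      _ ≤ _ := le_add_of_nonneg_left (num_nonneg _)) hlt
  obtain ⟨c, hc, h⟩ := exists_isFinsetCode
    -- The first component admits `a` and `b`, and forces x + 1 ≤ (a + 1) + (b + 1) for every member
    -- x.
    (c := pair (pair (a + b + 1) m) ((m * (a + 1) + 1) * (m * (b + 1) + 1))) ⟨_, _, _, rfl⟩
  refine ⟨c, hc, fun x => (h x).trans ⟨?_, ?_⟩⟩
  · rintro ⟨k, m', n, heq, hx, q, hq⟩
    obtain ⟨hk, rfl⟩ := pair_inj.1 heq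
    obtain ⟨rfl, rfl⟩ := pair_inj.1 hk
    have := eq_or_eq_of_dvd (le_add_of_nonneg_left (num_nonneg x))
      (calc x + 1 ≤ a + b + 1 := add_one_le_iff.2 hx
        _ ≤ a + b + 1 + 1 := le_add_of_nonneg_right (num_nonneg _)
        _ = a + 1 + (b + 1) := by ring) hlt hm1 hq
    simpa using this
  · rintro (rfl | rfl)
    · exact ⟨_, _, _, rfl, lt_add_one_iff.2 (le_add_of_nonneg_right (num_nonneg _)),
        m * (b + 1) + 1, by ring⟩
    · exact ⟨_, _, _, rfl, lt_add_one_iff.2 (le_add_of_nonneg_left (num_nonneg _)),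
        m * (a + 1) + 1, by ring⟩

/-! ## Finite sequences -/

theorem isSeqOfLength_iff_bounded {s l : M.Num} : IsSeqOfLength s l ↔
    IsFinsetCode s ∧ (∀ x < s, CodeMem x s → ∃ i < x + 1, ∃ j < x + 1, x = pair i j) ∧
    (∀ i < s, ∀ j < s, ∀ k < s, CodeMem (pair i j) s → CodeMem (pair i k) s → j = k) ∧
    ∀ i < s + l, (i < l ↔ ∃ j < s, CodeMem (pair i j) s) := by
  refine and_congr_right fun _ => and_congr ?_ (and_congr ?_ ?_)
  · constructor
    · intro h x _ hx
      obtain ⟨i, j, rfl⟩ := h x hx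
      exact ⟨i, lt_add_one_iff.2 (le_pair_left i j), j, lt_add_one_iff.2 (le_pair_right i j), rfl⟩
    · intro h x hx
      obtain ⟨i, -, j, -, hij⟩ := h x (lt_of_codeMem hx) hx
      exact ⟨i, j, hij⟩
  · exact ⟨fun h i _ j _ k _ => h i j k, fun h i j k hj hk => h i (lt_of_codeMem_pair_left hj)
      j (lt_of_codeMem_pair_right hj) k (lt_of_codeMem_pair_right hk) hj hk⟩
  · constructor
    · exact fun h i _ => (h i).trans
        ⟨fun ⟨j, hj⟩ => ⟨j, lt_of_codeMem_pair_right hj, hj⟩, fun ⟨j, _, hj⟩ => ⟨j, hj⟩⟩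
    · refine fun h i => ⟨fun hi => ?_, fun ⟨j, hj⟩ => ?_⟩
      · obtain ⟨j, -, hj⟩ := (h i (hi.trans_le (le_add_of_nonneg_left (num_nonneg _)))).1 hi
        exact ⟨j, hj⟩
      · exact (h i ((lt_of_codeMem_pair_left hj).trans_le
          (le_add_of_nonneg_right (num_nonneg _)))).2 ⟨j, lt_of_codeMem_pair_right hj, hj⟩

theorem Bd.isSeqOfLength {V : ℕ → M.sets} {n : ℕ} {s t : (Fin n → M.Num) → M.Num}
    (hs : Tm n s) (ht : Tm n t) : Bd V n fun v => IsSeqOfLength (s v) (t v) := by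
  refine Bd.congr ?_ fun v => isSeqOfLength_iff_bounded
  refine .and (.isFinsetCode hs) (.and ?_ (.and ?_ ?_))
  · refine ball hs (.imp (.codeMem (.var _) hs.init) ?_)
    exact bex ((Tm.var _).add .one) (bex ((Tm.var _).add .one)
      (.eq (.var _) ((Tm.var _).pair (.var _))))
  · refine ball hs (ball hs.init (ball hs.init.init ?_))
    exact .imp (.codeMem ((Tm.var _).pair (.var _)) hs.init.init.init)
      (.imp (.codeMem ((Tm.var _).pair (.var _)) hs.init.init.init) (.eq (.var _) (.var _)))
  · refine ball (hs.add ht) (.iff (.lt (.var _) ht.init) ?_)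
    exact bex hs.init (.codeMem ((Tm.var _).pair (.var _)) hs.init.init)

theorem exists_seq_singleton (i : M.Num) :
    ∃ s : M.Num, IsSeqOfLength s 1 ∧ ∀ x, CodeMem x s ↔ x = pair 0 i := by
  obtain ⟨s, hs, h⟩ := exists_code_pair (pair 0 i) (pair 0 i)
  simp only [or_self] at h
  refine ⟨s, ⟨hs, fun x hx => ⟨0, i, (h x).1 hx⟩, fun a b c hb hc => ?_, fun a => ?_⟩, h⟩
  · rw [h, pair_inj] at hb hc
    rw [hb.2, hc.2]
  · simp only [h, pair_inj, exists_and_left, exists_eq, and_true]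
    rw [← zero_add (1 : M.Num), lt_add_one_iff]
    exact ⟨fun h => h.antisymm (num_nonneg _), fun h => h.le⟩

theorem exists_seq_pair (i n : M.Num) :
    ∃ s : M.Num, IsSeqOfLength s (1 + 1) ∧ ∀ x, CodeMem x s ↔ x = pair 0 i ∨ x = pair 1 n := by
  obtain ⟨s, hs, h⟩ := exists_code_pair (pair 0 i) (pair 1 n)
  refine ⟨s, ⟨hs, fun x hx => ?_, fun a b c hb hc => ?_, fun a => ?_⟩, h⟩
  · rcases (h x).1 hx with h | h
    exacts [⟨_, _, h⟩, ⟨_, _, h⟩]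
  · rw [h, pair_inj, pair_inj] at hb hc
    rcases hb with ⟨rfl, rfl⟩ | ⟨rfl, rfl⟩ <;> rcases hc with ⟨h0, rfl⟩ | ⟨h0, rfl⟩
    exacts [rfl, (zero_ne_one h0).elim, (one_ne_zero h0).elim, rfl]
  · simp only [h, pair_inj, exists_or, exists_and_left, exists_eq, and_true]
    rw [lt_add_one_iff, le_iff_lt_or_eq]
    refine or_congr_left ?_
    rw [← zero_add (1 : M.Num), lt_add_one_iff]
    exact ⟨fun h => h.antisymm (num_nonneg _), fun h => h.le⟩

theorem InitialSegment.length_le {s t l l' : M.Num} (h : InitialSegment s t)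
    (hs : IsSeqOfLength s l) (ht : IsSeqOfLength t l') : l ≤ l' := by
  by_contra! hlt
  obtain ⟨j, hj⟩ := (hs.2.2.2 l').1 hlt
  exact lt_irrefl l' ((ht.2.2.2 l').2 ⟨j, h.2.2 _ _ hj⟩)

end Structure

end SecondOrderArithmetic

namespace SecondOrderArithmetic

namespace Structure

variable {M : Structure.{u}}

/-! ## Projections of sets -/

variable (M) in
/-- Every set of pairs in `M` has a projection to the first coordinate in `M`. -/
def ProjectionsExist : Prop :=
  ∀ G ∈ M.sets, ∃ X ∈ M.sets, ∀ n : M.Num, n ∈ X ↔ ∃ a, pair n a ∈ G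

theorem ModelsACA0.projectionsExist (h : M.ModelsACA0) : M.ProjectionsExist := by
  intro G hG
  obtain ⟨X, hX, h⟩ := h.comprehension
    (.ex 1 (.mem (.add (.mul (.add (.var 0) (.var 1)) (.add (.var 0) (.var 1))) (.var 0)) 0)) 0
    (fun _ => 0) (fun _ => G) trivial (fun _ => hG)
  exact ⟨X, hX, fun n => (h n).trans (by simp [Sat, eval, pair])⟩

/-- Needed where the witness `b` has no evident bound by a term, so that `Bd.comprehension` does not
apply. -/
theorem Bd.delta_comprehension {V : ℕ → M.sets} {n : ℕ}
    {P Q : (Fin n → M.Num) → M.Num → M.Num → Prop} (hM : M.ModelsRCA0)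
    (hP : Bd V (n + 2) fun v =>
      P (Fin.init (Fin.init v)) ((Fin.init v : Fin (n + 1) → M.Num) (Fin.last n)) (v (Fin.last _)))
    (hQ : Bd V (n + 2) fun v =>
      Q (Fin.init (Fin.init v)) ((Fin.init v : Fin (n + 1) → M.Num) (Fin.last n)) (v (Fin.last _)))
    (w : Fin n → M.Num) (hPQ : ∀ a, (∃ b, P w a b) ↔ ∀ b, Q w a b) :
    ∃ X ∈ M.sets, ∀ a, a ∈ X ↔ ∃ b, P w a b := by
  obtain ⟨u, rfl⟩ := exists_extend w
  obtain ⟨φ, hφ, h⟩ := hP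
  obtain ⟨ψ, hψ, h'⟩ := hQ
  have := hM.comprehension (.ex (n + 1) φ) (.all (n + 1) ψ) n u (fun i => V i) ⟨_, _, hφ, rfl⟩
    ⟨_, _, hψ, rfl⟩ (fun i => (V i).2)
  simp only [Sat, h, h', restrict_update, Fin.val_last, Function.update_self] at this
  exact this hPQ

variable [hM : Fact M.ModelsRCA0]

/-! ### Leaf sets and projections -/

theorem ProjectionsExist.leafSetsExist (h : M.ProjectionsExist) : M.LeafSetsExist := by
  intro T hT hTree
  -- Pairs of `s` and a proper extension in `T`. `IsSeq` is left out, being automatic in a tree, and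
  -- inclusion need only be tested below `s`.
  obtain ⟨G, hG, hGmem⟩ := Bd.comprehension (V := fun _ => ⟨T, hT⟩) (n := 0)
    (P := fun _ c => ∃ s < c + 1, ∃ t < c + 1, c = pair s t ∧ t ∈ T ∧
      (∀ i < s, ∀ j < s, CodeMem (pair i j) s → CodeMem (pair i j) t) ∧ t ≠ s) hM.out
    (.bex ((Tm.var _).add .one) (.bex ((Tm.var _).add .one) (.and (.eq (.var _)
      ((Tm.var _).pair (.var _))) (.and (.mem 0 (.var _)) (.and (.ball (.var _) (.ball (.var _)
        (.imp (.codeMem ((Tm.var _).pair (.var _)) (.var _))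
          (.codeMem ((Tm.var _).pair (.var _)) (.var _))))) (.not (.eq (.var _) (.var _)))))))) ![]
  obtain ⟨X, hX, hXmem⟩ := h G hG
  obtain ⟨L, hL, hLmem⟩ := Bd.comprehension (n := 0) (P := fun _ s => s ∈ T ∧ s ∉ X)
    (V := fun i => if i = 0 then ⟨T, hT⟩ else ⟨X, hX⟩) hM.out
    (.and (.mem 0 (.var _)) (.not (.mem 1 (.var _)))) ![]
  refine ⟨L, hL, fun s => (hLmem s).trans (and_congr_right fun hs => ?_)⟩
  rw [hXmem]
  push Not
  refine forall_congr' fun t => ?_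
  rw [hGmem]
  constructor
  · intro h ht hst
    by_contra hne
    exact h ⟨s, lt_add_one_iff.2 (le_pair_left s t), t, lt_add_one_iff.2 (le_pair_right s t), rfl,
      ht, fun i _ j _ => hst.2.2 i j, hne⟩
  · rintro h ⟨s', -, t', -, heq, ht, hst, hne⟩
    obtain ⟨rfl, rfl⟩ := pair_inj.1 heq
    exact hne (h ht ⟨hTree.1 s hs, hTree.1 t ht, fun i j hij =>
      hst i (lt_of_codeMem_pair_left hij) j (lt_of_codeMem_pair_right hij) hij⟩)

theorem LeafSetsExist.projectionsExist (h : M.LeafSetsExist) : M.ProjectionsExist := by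
  intro G hG
  -- Sequences of length at most 2; the condition on `G` is vacuous unless both entries are present.
  obtain ⟨T, hT, hTmem⟩ := Bd.comprehension (V := fun _ => ⟨G, hG⟩) (n := 0)
    (P := fun _ s => (∃ l < 1 + 1 + 1, IsSeqOfLength s l) ∧ ∀ i < s, ∀ n < s,
      CodeMem (pair 0 i) s → CodeMem (pair 1 n) s → pair i n ∈ G) hM.out
    (.and (.bex ((Tm.one.add .one).add .one) (.isSeqOfLength (.var _) (.var _)))
      (.ball (.var _) (.ball (.var _) (.imp (.codeMem (Tm.zero.pair (.var _)) (.var _))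
        (.imp (.codeMem (Tm.one.pair (.var _)) (.var _))
          (.mem 0 ((Tm.var _).pair (.var _)))))))) ![]
  have hTree : IsTree T := by
    refine ⟨fun s hs => ?_, fun s t ht hst => ?_⟩
    · obtain ⟨⟨l, -, hl⟩, -⟩ := (hTmem s).1 hs
      exact ⟨l, hl⟩
    · obtain ⟨⟨l, hl3, hl⟩, hG⟩ := (hTmem t).1 ht
      obtain ⟨l', hl'⟩ := hst.1
      refine (hTmem s).2 ⟨⟨l', (hst.length_le hl' hl).trans_lt hl3, hl'⟩, fun i _ n _ hi hn => ?_⟩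
      have hi := hst.2.2 _ _ hi
      have hn := hst.2.2 _ _ hn
      exact hG i (lt_of_codeMem_pair_right hi) n (lt_of_codeMem_pair_right hn) hi hn
  obtain ⟨L, hL, hLmem⟩ := h T hT hTree
  have key : ∀ i s : M.Num, IsSeqOfLength s 1 → (∀ x, CodeMem x s ↔ x = pair 0 i) →
      (s ∉ L ↔ ∃ n, pair i n ∈ G) := by
    intro i s hs hmem
    have hsT : s ∈ T := by
      refine (hTmem s).2 ⟨⟨1, by simp, hs⟩, fun j _ n _ _ hn => ?_⟩
      rw [hmem, pair_inj] at hn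
      exact (one_ne_zero hn.1).elim
    rw [hLmem]
    constructor
    · intro hleaf
      by_contra! hno
      refine hleaf ⟨hsT, fun t ht hst => ?_⟩
      obtain ⟨⟨l, hl3, hl⟩, hG⟩ := (hTmem t).1 ht
      have h0 : CodeMem (pair 0 i) t := hst.2.2 _ _ ((hmem _).2 rfl)
      -- An entry of `t` at index 1 would put a pair (i, b) into `G`, so `t` has the same members as
      -- ⟨i⟩.
      refine hl.1.eq hs.1 fun x => ⟨fun hx => ?_, fun hx => ?_⟩
      · obtain ⟨a, b, rfl⟩ := hl.2.1 x hx
        have ha1 : a < 1 + 1 := (((hl.2.2.2 a).2 ⟨b, hx⟩).trans_le (lt_add_one_iff.1 hl3))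
        rw [lt_add_one_iff, le_iff_lt_or_eq, ← zero_add (1 : M.Num), lt_add_one_iff, zero_add] at ha1
        rcases ha1 with ha1 | rfl
        · obtain rfl := ha1.antisymm (num_nonneg _)
          rw [hmem, hl.2.2.1 _ _ _ hx h0]
        · exact (hno b (hG i (lt_of_codeMem_pair_right h0) b (lt_of_codeMem_pair_right hx) h0
            hx)).elim
      · rw [hmem] at hx
        rwa [hx]
    · rintro ⟨n, hn⟩ hleaf
      obtain ⟨t, ht, htmem⟩ := exists_seq_pair i n
      have htT : t ∈ T := by
        refine (hTmem t).2 ⟨⟨1 + 1, by simp, ht⟩, fun j _ k _ hj hk => ?_⟩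
        rw [htmem, pair_inj, pair_inj] at hj hk
        rw [(hj.resolve_right fun h => zero_ne_one h.1).2,
          (hk.resolve_left fun h => one_ne_zero h.1).2]
        exact hn
      have hts := hleaf.2 t htT ⟨⟨1, hs⟩, ⟨_, ht⟩, fun a b hab => by
        rw [hmem] at hab
        rw [htmem, hab]
        exact .inl rfl⟩
      have h1 := (htmem (pair 1 n)).2 (.inr rfl)
      rw [hts, hmem, pair_inj] at h1
      exact one_ne_zero h1.1
  -- The code of ⟨i⟩ exists and is determined by i, up to the equivalence in `key`, so "some code of
  -- ⟨i⟩ is outside `L`" and "every code of ⟨i⟩ is outside `L`" agree.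
  obtain ⟨X, hX, hXmem⟩ := Bd.delta_comprehension (V := fun _ => ⟨L, hL⟩) (n := 0)
    (P := fun _ i s => (IsSeqOfLength s 1 ∧ CodeMem (pair 0 i) s ∧
      ∀ x < s, CodeMem x s → x = pair 0 i) ∧ s ∉ L)
    (Q := fun _ i s => (IsSeqOfLength s 1 ∧ CodeMem (pair 0 i) s ∧
      ∀ x < s, CodeMem x s → x = pair 0 i) → s ∉ L) hM.out
    (.and (.and (.isSeqOfLength (.var _) .one) (.and (.codeMem (Tm.zero.pair (.var _)) (.var _))
      (.ball (.var _) (.imp (.codeMem (.var _) (.var _)) (.eq (.var _) (Tm.zero.pair (.var _)))))))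
      (.not (.mem 0 (.var _))))
    (.imp (.and (.isSeqOfLength (.var _) .one) (.and (.codeMem (Tm.zero.pair (.var _)) (.var _))
      (.ball (.var _) (.imp (.codeMem (.var _) (.var _)) (.eq (.var _) (Tm.zero.pair (.var _)))))))
      (.not (.mem 0 (.var _)))) ![] (by
    intro i
    have hext : ∀ s, (IsSeqOfLength s 1 ∧ CodeMem (pair 0 i) s ∧
        ∀ x < s, CodeMem x s → x = pair 0 i) → (s ∉ L ↔ ∃ n, pair i n ∈ G) :=
      fun s hs => key i s hs.1 fun x => ⟨fun hx => hs.2.2 x (lt_of_codeMem hx) hx, fun hx => by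
        rw [hx]; exact hs.2.1⟩
    obtain ⟨s, hs, hmem⟩ := exists_seq_singleton i
    constructor
    · rintro ⟨b, hb, hbL⟩ c hc
      exact (hext c hc).2 ((hext b hb).1 hbL)
    · intro h
      have hs' := And.intro hs (And.intro ((hmem _).2 rfl) fun x (_ : x < s) => (hmem x).1)
      exact ⟨s, hs', h s hs'⟩)
  refine ⟨X, hX, fun i => (hXmem i).trans ⟨?_, ?_⟩⟩
  · rintro ⟨s, ⟨h1, h2, h3⟩, hsL⟩
    exact (key i s h1 fun x => ⟨fun hx => h3 x (lt_of_codeMem hx) hx, fun hx => by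
      rw [hx]; exact h2⟩).1 hsL
  · intro h
    obtain ⟨s, hs, hmem⟩ := exists_seq_singleton i
    exact ⟨s, ⟨hs, (hmem _).2 rfl, fun x _ => (hmem x).1⟩, (key i s hs hmem).2 h⟩

/-! ### Parallelized LPO and projections -/

theorem ProjectionsExist.parallelLPO (h : M.ProjectionsExist) : M.ParallelLPO := by
  intro p hp _
  obtain ⟨G, hG, hGmem⟩ := Bd.comprehension (V := fun _ => ⟨p, hp⟩) (n := 0)
    (P := fun _ c => pair c 0 ∈ p) hM.out (.mem 0 ((Tm.var _).pair .zero)) ![]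
  obtain ⟨X, hX, hXmem⟩ := h G hG
  obtain ⟨z, hz, hzmem⟩ := Bd.comprehension (V := fun _ => ⟨X, hX⟩) (n := 0)
    (P := fun _ c => ∃ i < c + 1, (i ∈ X ∧ c = pair i 1) ∨ (i ∉ X ∧ c = pair i 0)) hM.out
    (.bex ((Tm.var _).add .one) (.or (.and (.mem 0 (.var _)) (.eq (.var _) ((Tm.var _).pair .one)))
      (.and (.not (.mem 0 (.var _))) (.eq (.var _) ((Tm.var _).pair .zero))))) ![]
  have hz' : ∀ i j, pair i j ∈ z ↔ (i ∈ X ∧ j = 1) ∨ (i ∉ X ∧ j = 0) := by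
    intro i j
    rw [hzmem]
    constructor
    · rintro ⟨i', -, h⟩
      simp only [pair_inj] at h
      rcases h with ⟨h, rfl, rfl⟩ | ⟨h, rfl, rfl⟩
      exacts [.inl ⟨h, rfl⟩, .inr ⟨h, rfl⟩]
    · intro h
      refine ⟨i, lt_add_one_iff.2 (le_pair_left i j), ?_⟩
      simpa only [pair_inj, true_and] using h
  refine ⟨z, hz, ⟨fun c hc => ?_, fun i _ => ?_⟩, fun i => ?_⟩
  · obtain ⟨i, -, ⟨-, rfl⟩ | ⟨-, rfl⟩⟩ := (hzmem c).1 hc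
    exacts [⟨i, trivial, 1, .inr rfl, rfl⟩, ⟨i, trivial, 0, .inl rfl, rfl⟩]
  · by_cases hi : i ∈ X
    · exact ⟨1, (hz' i 1).2 (.inl ⟨hi, rfl⟩), fun j hj =>
        (((hz' i j).1 hj).resolve_right fun h => h.1 hi).2⟩
    · exact ⟨0, (hz' i 0).2 (.inr ⟨hi, rfl⟩), fun j hj =>
        (((hz' i j).1 hj).resolve_left fun h => hi h.1).2⟩
  · rw [hz', or_iff_left fun h => one_ne_zero h.2, hXmem]
    simp only [hGmem, and_true]

theorem ParallelLPO.projectionsExist (h : M.ParallelLPO) : M.ProjectionsExist := by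
  intro G hG
  -- Pairing is not surjective, so `d` must be required to be a pair for `p` to have domain ℕ × ℕ.
  obtain ⟨p, hp, hpmem⟩ := Bd.comprehension (V := fun _ => ⟨G, hG⟩) (n := 0)
    (P := fun _ c => ∃ d < c + 1, (∃ i < d + 1, ∃ n < d + 1, d = pair i n) ∧
      ((d ∈ G ∧ c = pair d 0) ∨ (d ∉ G ∧ c = pair d 1))) hM.out
    (.bex ((Tm.var _).add .one) (.and (.bex ((Tm.var _).add .one) (.bex ((Tm.var _).add .one)
        (.eq (.var _) ((Tm.var _).pair (.var _)))))
      (.or (.and (.mem 0 (.var _)) (.eq (.var _) ((Tm.var _).pair .zero)))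
        (.and (.not (.mem 0 (.var _))) (.eq (.var _) ((Tm.var _).pair .one)))))) ![]
  have hp' : ∀ i n j, pair (pair i n) j ∈ p ↔
      (pair i n ∈ G ∧ j = 0) ∨ (pair i n ∉ G ∧ j = 1) := by
    intro i n j
    rw [hpmem]
    constructor
    · rintro ⟨d, -, -, h⟩
      simp only [pair_inj (i := pair i n)] at h
      rcases h with ⟨h, rfl, rfl⟩ | ⟨h, rfl, rfl⟩
      exacts [.inl ⟨h, rfl⟩, .inr ⟨h, rfl⟩]
    · intro h
      refine ⟨pair i n, lt_add_one_iff.2 (le_pair_left _ j), ⟨i, lt_add_one_iff.2 (le_pair_left _ _),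
        n, lt_add_one_iff.2 (le_pair_right _ _), rfl⟩, ?_⟩
      simpa only [pair_inj, true_and] using h
  obtain ⟨z, hz, hzfun, hzmem⟩ := h p hp (by
    refine ⟨fun c hc => ?_, ?_⟩
    · obtain ⟨d, -, ⟨i, -, n, -, hd⟩, h⟩ := (hpmem c).1 hc
      rcases h with ⟨-, h⟩ | ⟨-, h⟩
      exacts [⟨d, ⟨i, trivial, n, trivial, hd⟩, 0, trivial, h⟩,
        ⟨d, ⟨i, trivial, n, trivial, hd⟩, 1, trivial, h⟩]
    · rintro _ ⟨i, -, n, -, rfl⟩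
      by_cases hi : pair i n ∈ G
      · exact ⟨0, (hp' i n 0).2 (.inl ⟨hi, rfl⟩), fun j hj =>
          (((hp' i n j).1 hj).resolve_right fun h => h.1 hi).2⟩
      · exact ⟨1, (hp' i n 1).2 (.inr ⟨hi, rfl⟩), fun j hj =>
          (((hp' i n j).1 hj).resolve_left fun h => hi h.1).2⟩)
  obtain ⟨X, hX, hXmem⟩ := Bd.comprehension (V := fun _ => ⟨z, hz⟩) (n := 0)
    (P := fun _ c => pair c 1 ∈ z) hM.out (.mem 0 ((Tm.var _).pair .one)) ![]
  refine ⟨X, hX, fun i => ?_⟩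
  rw [hXmem, hzmem]
  simp only [hp', and_true, zero_ne_one, and_false, or_false]

end Structure

end SecondOrderArithmetic

namespace SecondOrderArithmetic

namespace Structure

variable {M : Structure.{u}}

/-! ## Arithmetical comprehension from projections -/

/-- The code of the tuple of the first `k` values of `u`. -/
def tup (u : ℕ → M.Num) : ℕ → M.Num
  | 0 => 0
  | k + 1 => pair (tup u k) (u k)

/-- The term `pair s t`. -/
def pairTerm (s t : Term) : Term := .add (.mul (.add s t) (.add s t)) s

/-- The term for the code of the tuple of the first `k` terms of `f`. -/
def tupTerm (f : ℕ → Term) : ℕ → Term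
  | 0 => .zero
  | k + 1 => pairTerm (tupTerm f k) (f k)

theorem eval_tupTerm (f : ℕ → Term) (u : ℕ → M.Num) (k : ℕ) :
    M.eval u (tupTerm f k) = tup (fun i => M.eval u (f i)) k := by
  induction k with
  | zero => rfl
  | succ k ih => simp only [tupTerm, tup, pairTerm, eval, ih, pair]

theorem tup_congr {u u' : ℕ → M.Num} {k : ℕ} (h : ∀ i < k, u i = u' i) : tup u k = tup u' k := by
  induction k with
  | zero => rfl
  | succ k ih =>
    simp only [tup]
    rw [ih fun i hi => h i (hi.trans (Nat.lt_succ_self k)), h k (Nat.lt_succ_self k)]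

/-- `φ` preceded by quantifiers `∃ i < k + 1` (where `k` is a variable) for each variable `i < j`. -/
def bexs (k : ℕ) : ℕ → Formula → Formula
  | 0, φ => φ
  | j + 1, φ => bexs k j (.bexLt j (.add (.var k) .one) φ)

theorem isBounded_bexs {k j : ℕ} (hj : j ≤ k) {φ : Formula} (hφ : φ.IsBounded) :
    (bexs k j φ).IsBounded := by
  induction j generalizing φ with
  | zero => exact hφ
  | succ j ih =>
    refine ih (by omega) (.bexLt ?_ hφ)
    simp only [Term.vars, Finset.union_empty, Finset.mem_singleton]
    omega

/-- The block of quantifiers chooses a new assignment at once. Since j ≤ k, the bounding variable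
`k` is never overwritten. -/
theorem sat_bexs {k j : ℕ} (hj : j ≤ k) (φ : Formula) (u : ℕ → M.Num) (V : ℕ → Set M.Num) :
    M.Sat (bexs k j φ) u V ↔
      ∃ u' : ℕ → M.Num, (∀ i, j ≤ i → u' i = u i) ∧ (∀ i < j, u' i < u k + 1) ∧ M.Sat φ u' V := by
  induction j generalizing φ with
  | zero =>
    constructor
    · exact fun h => ⟨u, fun _ _ => rfl, fun i hi => (Nat.not_lt_zero i hi).elim, h⟩
    · rintro ⟨u', h, -, hu'⟩
      rwa [show u' = u from funext fun i => h i (Nat.zero_le i)] at hu'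
  | succ j ih =>
    rw [bexs, ih (by omega)]
    have hkj : k ≠ j := by omega
    constructor
    · rintro ⟨u', h, hb, a, ha, hφ⟩
      simp only [Sat, eval, Function.update_self, Function.update_of_ne hkj] at ha
      refine ⟨Function.update u' j a, fun i hi => ?_, fun i hi => ?_, hφ⟩
      · rw [Function.update_of_ne (by omega), h i (by omega)]
      · by_cases hij : i = j
        · rw [hij, Function.update_self, ← h k (by omega)]
          exact ha
        · rw [Function.update_of_ne hij]
          exact hb i (by omega)
    · rintro ⟨u', h, hb, hφ⟩
      -- The outer block must leave variable `j` alone; the innermost quantifier then restores its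
      -- value `u' j`.
      refine ⟨Function.update u' j (u j), fun i hi => ?_, fun i hi => ?_, u' j, ?_, ?_⟩
      · by_cases hij : i = j
        · rw [hij, Function.update_self]
        · rw [Function.update_of_ne hij, h i (by omega)]
      · rw [Function.update_of_ne (by omega)]
        exact hb i (by omega)
      · simp only [Sat, eval, Function.update_self, Function.update_of_ne hkj]
        rw [h k (by omega)]
        exact hb j (by omega)
      · simpa using hφ

/-- The predicate `P` on assignments is given, via codes of tuples of length `k`, by a set in `M`. -/
def Represents (P : (ℕ → M.Num) → Prop) (k : ℕ) : Prop :=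
  ∃ X ∈ M.sets, ∀ u : ℕ → M.Num, tup u k ∈ X ↔ P u

theorem Represents.congr {P Q : (ℕ → M.Num) → Prop} {k : ℕ} (h : Represents P k) (hPQ : ∀ u, Q u ↔ P u) : Represents Q k := by
  obtain rfl : Q = P := funext fun u => propext (hPQ u)
  exact h

variable [hM : Fact M.ModelsRCA0]

theorem le_tup (u : ℕ → M.Num) {i k : ℕ} (h : i < k) : u i ≤ tup u k := by
  induction k with
  | zero => omega
  | succ k ih =>
    rcases Nat.lt_succ_iff_lt_or_eq.1 h with h | rfl
    · exact (ih h).trans (le_pair_left _ _)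
    · exact le_pair_right _ _

theorem eq_of_tup_eq {u u' : ℕ → M.Num} {i k : ℕ} (h : tup u k = tup u' k) (hi : i < k) :
    u i = u' i := by
  induction k with
  | zero => omega
  | succ k ih =>
    obtain ⟨h1, h2⟩ := pair_inj.1 h
    rcases Nat.lt_succ_iff_lt_or_eq.1 hi with hi | rfl
    exacts [ih h1 hi, h2]

/-- Variable `k` holds the code, and the first `k` variables are decoded by bounded quantifiers,
since entries never exceed the code. Injectivity of tuple codes makes the decoding unique. -/
theorem exists_set_of_bounded {θ : Formula} (hθ : θ.IsBounded) (V : ℕ → M.sets) {k : ℕ}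
    (hk : ∀ u u' : ℕ → M.Num, (∀ i < k, u i = u' i) →
      (M.Sat θ u (fun i => V i) ↔ M.Sat θ u' (fun i => V i))) :
    ∃ X ∈ M.sets, ∀ u : ℕ → M.Num, tup u k ∈ X ↔ M.Sat θ u (fun i => V i) := by
  obtain ⟨X, hX, h⟩ := bounded_comprehension hM.out.comprehension
    (isBounded_bexs le_rfl (.and (.eq (.var k) (tupTerm .var k)) hθ)) k (fun _ => 0) V
  refine ⟨X, hX, fun u => ?_⟩
  rw [h, sat_bexs le_rfl]
  simp only [Sat, eval_tupTerm, eval]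
  constructor
  · rintro ⟨u', h, -, htup, hsat⟩
    rw [h k le_rfl, Function.update_self] at htup
    exact (hk u u' fun i hi => eq_of_tup_eq htup hi).2 hsat
  · intro hsat
    have hagree : ∀ i < k, u i = if i < k then u i else if i = k then tup u k else 0 :=
      fun i hi => by simp [hi]
    -- Beyond `k` the value is 0, to agree with the assignment used in the comprehension.
    refine ⟨fun i => if i < k then u i else if i = k then tup u k else 0, fun i hi => ?_,
      fun i hi => ?_, ?_, (hk _ _ hagree).1 hsat⟩
    · simp [hi.not_gt, Function.update_apply]
    · simp only [hi, if_true, Function.update_self]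
      exact lt_add_one_iff.2 (le_tup u hi)
    · simp only [lt_irrefl, if_true, if_false]
      exact tup_congr hagree

namespace Represents

variable {P Q : (ℕ → M.Num) → Prop} {k l : ℕ}

theorem succ (h : Represents P k) : Represents P (k + 1) := by
  obtain ⟨X, hX, h⟩ := h
  obtain ⟨Y, hY, hYmem⟩ := Bd.comprehension (V := fun _ => ⟨X, hX⟩) (n := 0)
    (P := fun _ c => ∃ a < c + 1, ∃ b < c + 1, c = pair a b ∧ a ∈ X) hM.out
    (.bex ((Tm.var _).add .one) (.bex ((Tm.var _).add .one)
      (.and (.eq (.var _) ((Tm.var _).pair (.var _))) (.mem 0 (.var _))))) ![]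
  refine ⟨Y, hY, fun u => ?_⟩
  rw [hYmem, ← h]
  constructor
  · rintro ⟨a, -, b, -, hab, ha⟩
    rwa [(pair_inj.1 hab).1]
  · exact fun h => ⟨_, lt_add_one_iff.2 (le_pair_left _ _), _, lt_add_one_iff.2 (le_pair_right _ _),
      rfl, h⟩

theorem mono (h : Represents P k) (hkl : k ≤ l) : Represents P l := by
  induction hkl with
  | refl => exact h
  | step _ ih => exact ih.succ

theorem not (h : Represents P k) : Represents (fun u => ¬ P u) k := by
  obtain ⟨X, hX, h⟩ := h
  obtain ⟨Y, hY, hYmem⟩ := Bd.comprehension (V := fun _ => ⟨X, hX⟩) (n := 0)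
    (P := fun _ c => c ∉ X) hM.out (.not (.mem 0 (.var _))) ![]
  exact ⟨Y, hY, fun u => by rw [hYmem, h]⟩

theorem and (h : Represents P k) (h' : Represents Q l) :
    Represents (fun u => P u ∧ Q u) (max k l) := by
  obtain ⟨X, hX, h⟩ := h.mono (le_max_left k l)
  obtain ⟨X', hX', h'⟩ := h'.mono (le_max_right k l)
  obtain ⟨Y, hY, hYmem⟩ := Bd.comprehension (V := fun i => if i = 0 then ⟨X, hX⟩ else ⟨X', hX'⟩)
    (n := 0) (P := fun _ c => c ∈ X ∧ c ∈ X') hM.out (.and (.mem 0 (.var _)) (.mem 1 (.var _))) ![]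
  exact ⟨Y, hY, fun u => by rw [hYmem, h, h']⟩

/-- Once `K` exceeds `x` and the length of the representation, variable `K` can carry the quantified
value. `Y` holds the (K + 1)-tuples whose first K entries, with the last entry substituted at `x`,
are coded in `X`. A (K + 1)-tuple is a pair of a K-tuple and its last entry, so projecting `Y` is
quantifying over that value. -/
theorem ex (hproj : M.ProjectionsExist) (h : Represents P k) (x : ℕ) :
    Represents (fun u => ∃ a, P (Function.update u x a)) (max k (x + 1)) := by
  obtain ⟨X, hX, h⟩ := h.mono (le_max_left k (x + 1))
  have hx : x < max k (x + 1) := by omega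
  generalize max k (x + 1) = K at h hx
  have heval : ∀ u : ℕ → M.Num,
      M.eval u (tupTerm (fun i => if i = x then .var K else .var i) K) =
        tup (Function.update u x (u K)) K := by
    intro u
    rw [eval_tupTerm]
    refine tup_congr fun i _ => ?_
    by_cases hi : i = x
    · simp [hi, eval]
    · simp [hi, eval]
  obtain ⟨Y, hY, hYmem⟩ := exists_set_of_bounded (k := K + 1)
    (.mem (tupTerm (fun i => if i = x then .var K else .var i) K) 0) (fun _ => ⟨X, hX⟩) (by
      intro u u' huu'
      simp only [Sat]
      rw [heval, heval, huu' K (Nat.lt_succ_self K),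
        tup_congr fun i hi => update_agree huu' x (u' K) i (by omega)])
  obtain ⟨Z, hZ, hZmem⟩ := hproj Y hY
  refine ⟨Z, hZ, fun u => (hZmem _).trans (exists_congr fun a => ?_)⟩
  have := hYmem (Function.update u K a)
  simp only [tup, Sat, heval, Function.update_self] at this
  rw [tup_congr (u' := u) fun i hi => Function.update_of_ne hi.ne _ _] at this
  rw [this, Function.update_comm hx.ne',
    tup_congr (u' := Function.update u x a) fun i hi => Function.update_of_ne hi.ne _ _, h]

end Represents

/-- Atomic formulas are bounded, the connectives reduce to negation and conjunction, and ∀ is ¬∃¬;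
only ∃ uses projections. -/
theorem ProjectionsExist.represents (h : M.ProjectionsExist) {φ : Formula}
    (hφ : φ.IsArithmetical) (V : ℕ → M.sets) :
    ∃ k, Represents (fun u => M.Sat φ u fun i => V i) k := by
  have bounded : ∀ {θ : Formula}, θ.IsBounded →
      ∃ k, Represents (fun u => M.Sat θ u fun i => V i) k := by
    intro θ hθ
    obtain ⟨k, hk⟩ := exists_sat_congr M θ
    exact ⟨k, exists_set_of_bounded hθ V (hk _)⟩
  induction φ with
  | eq s t => exact bounded (.eq s t)
  | lt s t => exact bounded (.lt s t)
  | mem t X => exact bounded (.mem t X)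
  | neg φ ih =>
    obtain ⟨k, hk⟩ := ih hφ
    exact ⟨k, hk.not⟩
  | and φ ψ ih ih' =>
    obtain ⟨k, hk⟩ := ih hφ.1
    obtain ⟨l, hl⟩ := ih' hφ.2
    exact ⟨_, hk.and hl⟩
  | or φ ψ ih ih' =>
    obtain ⟨k, hk⟩ := ih hφ.1
    obtain ⟨l, hl⟩ := ih' hφ.2
    exact ⟨_, (hk.not.and hl.not).not.congr fun u => by simp only [Sat]; tauto⟩
  | imp φ ψ ih ih' =>
    obtain ⟨k, hk⟩ := ih hφ.1
    obtain ⟨l, hl⟩ := ih' hφ.2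
    exact ⟨_, (hk.and hl.not).not.congr fun u => by simp only [Sat]; tauto⟩
  | iff φ ψ ih ih' =>
    obtain ⟨k, hk⟩ := ih hφ.1
    obtain ⟨l, hl⟩ := ih' hφ.2
    exact ⟨_, ((hk.and hl.not).not.and (hl.and hk.not).not).congr fun u => by simp only [Sat]; tauto⟩
  | all x φ ih =>
    obtain ⟨k, hk⟩ := ih hφ
    exact ⟨_, (hk.not.ex h x).not.congr fun u => by simp only [Sat]; push Not; rfl⟩
  | ex x φ ih =>
    obtain ⟨k, hk⟩ := ih hφ
    exact ⟨_, hk.ex h x⟩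
  | allSet X φ => exact hφ.elim
  | exSet X φ => exact hφ.elim

theorem ProjectionsExist.modelsACA0 (h : M.ProjectionsExist) : M.ModelsACA0 where
  basic := hM.out.basic
  induction X hX h0 h1 := Bd.induction (V := fun _ => ⟨X, hX⟩) (n := 0) (P := fun _ a => a ∈ X)
    hM.out (.mem 0 (.var _)) ![] h0 h1
  comprehension φ x v V hφ hV := by
    obtain ⟨k, X, hX, hXmem⟩ := h.represents hφ fun i => ⟨V i, hV i⟩
    -- `Y` is the preimage of `X` under a term: the tuple code as a function of variable `x`, with
    -- the other entries fixed by `v`.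
    obtain ⟨Y, hY, hYmem⟩ := bounded_comprehension hM.out.comprehension
      (.mem (tupTerm .var k) 0) x v fun _ => ⟨X, hX⟩
    refine ⟨Y, hY, fun n => (hYmem n).trans ?_⟩
    simp only [Sat, eval_tupTerm]
    exact hXmem _

end Structure

end SecondOrderArithmetic

theorem proposition3 (M : SecondOrderArithmetic.Structure.{u}) (hM : M.ModelsRCA0) :
    List.TFAE [M.ModelsACA0, M.LeafSetsExist, M.ParallelLPO] := by
  have : Fact M.ModelsRCA0 := ⟨hM⟩
  tfae_have 1 → 2 := fun h => h.projectionsExist.leafSetsExist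
  tfae_have 2 → 3 := fun h => h.projectionsExist.parallelLPO
  tfae_have 3 → 1 := fun h => h.projectionsExist.modelsACA0
  tfae_finish
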